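/- Proposition 4. All electrical quantities are balanced three-phase signals in synchronized $dq$ frames rotating at $\omega_0>0$, so voltages and currents are vectors in $\mathbb R^2$. Put $J_2=\begin{pmatrix}0&1\\-1&0\end{pmatrix}$, and let $I_2$ be the $2\times2$ identity. Consider an islanded AC microgrid of arbitrary topology with the following subsystems. (i) Distributed generation units (DGUs) with $RLC$ filter parameters $R_t,L_t,C_t>0$. The open-loop port-Hamiltonian model, with state $x=(L_tI^d,L_tI^q,C_tV^d,C_tV^q)$ and Hamiltonian $H(x)=\tfrac12x^\top\mathrm{diag}(\tfrac1{L_t},\tfrac1{L_t},\tfrac1{C_t},\tfrac1{C_t})x$, is $$\dot x=[J-R]\nabla H(x)+Gu+Kd,\qquad z=K^\top\nabla H(x)=V,$$ $$J=\begin{pmatrix}\omega_0L_tJ_2&-I_2\\ I_2&\omega_0C_tJ_2\end{pmatrix},\quad R=\mathrm{diag}(R_t,R_t,0,0),\quad G=\begin{pmatrix}I_2\\0\end{pmatrix},\quad K=\begin{pmatrix}0\\I_2\end{pmatrix},$$ where $u$ is the voltage of the voltage source inverter (VSI), $d$ the interaction input and $z$ the interaction output. A DGU $i$ in a given set $\mathcal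 D_{\rm sat}$ has a saturated VSI: $u_i=\bar u_i=(\pm V^d_{\mathrm{sat},i},\pm V^q_{\mathrm{sat},i})$ is constant, with saturation limits $V^d_{\mathrm{sat},i},V^q_{\mathrm{sat},i}>0$ and any signs. Every other DGU has a voltage reference $V^*\in\mathbb R^2\setminus\{0\}$ and is controlled in one of two ways. (a) Port-Hamiltonian control with integral action, with parameters $\alpha_a<0$ and $\nu_a,k_a>0$ for $a=1,2$. The closed loop has state $\varkappa=(\varkappa_\alpha,\varkappa_\nu,\varkappa_e)\in\mathbb R^2\times\mathbb R^2\times\mathbb R^2$ with $\varkappa_\nu=C_tV$, and for a constant $\bar\varkappa_\alpha\in\mathbb R^2$ it reads, with $N=\mathrm{diag}(\nu_1,\nu_2)$, $A=\mathrm{diag}(\alpha_1,\alpha_2)$, $k=\mathrm{diag}(k_1,k_2)$, $$\dot\varkappa=\begin{pmatrix}A&-N&0\\N&\omega_0C_tJ_2&-k\\0&k&0\end{pmatrix}\begin{pmatrix}\tfrac1{L_t}N^{-1}(\varkappa_\alpha-\bar\varkappa_\alpha)\\V-V^*\\k^{-1}\varkappa_e\end{pmatrix}+\begin{pmatrix}0\\d\\0\end{pmatrix}.$$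 (b) Multi-variable PI control $u=K_{11}V+K_{12}I+K_{13}v$, $\dot v=V^*-V$, with real $2\times2$ gains. With the state $(C_tV,L_tI,v)$ the closed-loop matrix is $$F=\begin{pmatrix}\omega_0J_2&\tfrac1{L_t}I_2&0\\-\tfrac1{C_t}(I_2-K_{11})&\omega_0J_2-\tfrac{R_t}{L_t}I_2+\tfrac1{L_t}K_{12}&K_{13}\\-\tfrac1{C_t}I_2&0&0\end{pmatrix},$$ and the gains are assumed to be such that $F$ is Hurwitz and $F^\top P+PF\preceq0$ for some $P=\mathrm{blockdiag}(I_2,P_{22})$ with $P_{22}\succ0$. (ii) Lone-standing load nodes with $C>0$ and load current $I_{\rm load}$: $\;C\dot V=\omega_0CJ_2V-I_{\rm load}(V)+d$. (iii) Power lines with $R_l,L_l>0$ from a node $a$ to a node $b$ (each a DGU or a load node): $\;L_l\dot I_l=\omega_0L_lJ_2I_l-R_lI_l+V_a-V_b$. The interaction input $d$ of a DGU or load node is the sum of the currents of the incoming lines minus the sum of the currents of the outgoing lines. Any DGU may supply a local load, in which case $d$ is replaced by $d-I_{\rm load}(V)$ in its dynamics within the microgrid. All loads are ZIP or exponential loads.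 With $r=|V|=\sqrt{(V^d)^2+(V^q)^2}$ and $V\ne0$, $$I_{\rm load}(V)=g(r)V+h(r)J_2V,$$ where for a ZIP load $g(r)=\tfrac{P}{r^2}+\tfrac{I_p}{r}+Y_p$ and $h(r)=\tfrac{Q}{r^2}+\tfrac{I_q}{r}+Y_q$ with parameters $\ge0$, and for an exponential load $g(r)=P_0\,r^{n_p-2}/V_0^{n_p}$ and $h(r)=Q_0\,r^{n_q-2}/V_0^{n_q}$ with $P_0,Q_0,n_p,n_q\ge0$ and $V_0>0$. Let $\bar x$ be an equilibrium of the microgrid whose DGUs in $\mathcal D_{\rm sat}$ are saturated (the existence of a feasible equilibrium is the standing assumption on the higher-level control). Assume that all node voltages are nonzero at $\bar x$, and that at the voltage amplitude $r$ which its node has at $\bar x$ each load satisfies $$\text{ZIP: } Y_p+\tfrac{I_p}{2r}>0,\quad Y_p^2r^4+Y_pI_pr^3>\tfrac14I_q^2r^2+(I_pP+I_qQ)r+P^2+Q^2;$$ $$\text{exponential: } n_pP_0>0,\quad 4(n_p-1)P_0^2(r/V_0)^{2n_p}>(n_q-2)^2Q_0^2(r/V_0)^{2n_q}.$$ Then the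 following hold. 1. For each $i\in\mathcal D_{\rm sat}$ let $f_i(x,d)=[J_i-R_i]\nabla H_i(x)+G_i\bar u_i+K_id$ be the open-loop port-Hamiltonian model with the constant input $\bar u_i$, let $z=K_i^\top\nabla H_i(x)$ be its output, and let $\bar{\mathcal X}_i=\{\bar\xi:\ f_i(\bar\xi,\bar d)=0\text{ for some }\bar d\}$ be its set of equilibria. The component $\bar x_i$ of $\bar x$ lies in $\bar{\mathcal X}_i$, and the model is equilibrium-independent passive (EIP) on $\bar{\mathcal X}_i$: each $\bar\xi\in\bar{\mathcal X}_i$ has exactly one associated input $\bar d$, and there is a $C^1$ function $S:\mathbb R^4\times\bar{\mathcal X}_i\to\mathbb R_{\ge0}$ with $S(\bar\xi,\bar\xi)=0$ and $\nabla_\xi S(\xi,\bar\xi)^\top f_i(\xi,d)\le(d-\bar d)^\top(z-\bar z)$ for all $\xi\in\mathbb R^4$, $\bar\xi\in\bar{\mathcal X}_i$ and $d\in\mathbb R^2$, where $z$ is the output at $\xi$ and $\bar z$ the output at $\bar\xi$. 2. $\bar x$ is an asymptotically stable equilibrium of the microgrid. -/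

import Mathlib

open scoped Matrix Topology

noncomputable section

namespace ImG

/-! ## Ordinary differential equations and asymptotic stability -/

section Stability

variable {E : Type*} [NormedAddCommGroup E] [NormedSpace ℝ E]

/-- `x` solves the autonomous equation `x' = f x` on the time interval `I`
(one-sided derivatives at the end points of `I`). -/
def IsSolutionOn (f : E → E) (I : Set ℝ) (x : ℝ → E) : Prop :=
  ∀ t ∈ I, HasDerivWithinAt x (f (x t)) I t

/-- Asymptotic stability (in the sense of Lyapunov) of the equilibrium `xbar` of `x' = f x`.
Solutions that start near `xbar` exist for all times, every solution that starts near `xbar` stays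
near `xbar` as long as it exists, and it converges to `xbar` as `t → ∞`. -/
structure IsAsymptoticallyStable (f : E → E) (xbar : E) : Prop where
  equilibrium : f xbar = 0
  exists_solution : ∃ δ > 0, ∀ x₀ : E, dist x₀ xbar < δ →
    ∃ x : ℝ → E, x 0 = x₀ ∧ IsSolutionOn f (Set.Ici 0) x
  stable : ∀ ε > 0, ∃ δ > 0, ∀ (T : ℝ) (x : ℝ → E), IsSolutionOn f (Set.Icc 0 T) x →
    dist (x 0) xbar < δ → ∀ t ∈ Set.Icc 0 T, dist (x t) xbar < ε
  attractive : ∃ δ > 0, ∀ x : ℝ → E, IsSolutionOn f (Set.Ici 0) x →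
    dist (x 0) xbar < δ → Filter.Tendsto x Filter.atTop (𝓝 xbar)

end Stability

/-! ## Equilibrium-independent passivity -/

/-- The feasible equilibria of a system `x' = f x d`: the states that some constant input `d`
keeps at rest. -/
def feasibleEquilibria {n m : Type*} (f : (n → ℝ) → (m → ℝ) → (n → ℝ)) : Set (n → ℝ) :=
  {xbar | ∃ dbar, f xbar dbar = 0}

/-- The system `x' = f x d`, `z = h x d` is equilibrium-independent passive on the set `X` of
equilibria: each `xbar ∈ X` belongs to a unique input `dbar`, and there is a `C¹` storage function
`S x xbar ≥ 0` on `ℝⁿ × X`, vanishing at `x = xbar`, whose derivative along the system is at most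
the shifted supply rate `(d - dbar)ᵀ (z - zbar)`. -/
def IsEIP {n m : Type*} [Fintype n] [Fintype m]
    (f : (n → ℝ) → (m → ℝ) → (n → ℝ)) (h : (n → ℝ) → (m → ℝ) → (m → ℝ))
    (X : Set (n → ℝ)) : Prop :=
  (∀ xbar ∈ X, ∃! dbar, f xbar dbar = 0) ∧
  ∃ S : (n → ℝ) → (n → ℝ) → ℝ,
    ContDiffOn ℝ 1 (fun p : (n → ℝ) × (n → ℝ) => S p.1 p.2) (Set.univ ×ˢ X) ∧
    (∀ x, ∀ xbar ∈ X, 0 ≤ S x xbar ∧ S xbar xbar = 0) ∧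
    ∀ x, ∀ xbar ∈ X, ∀ d dbar, f xbar dbar = 0 →
      fderiv ℝ (fun y => S y xbar) x (f x d) ≤ (d - dbar) ⬝ᵥ (h x d - h xbar dbar)

/-! ## Nonlinear static loads

All dq quantities are vectors `Fin 2 → ℝ`, with d component `0` and q component `1`. -/

/-- The amplitude of a dq voltage. -/
def amplitude (V : Fin 2 → ℝ) : ℝ := Real.sqrt (V 0 ^ 2 + V 1 ^ 2)

/-- Parameters of a ZIP load: active (`p`) and reactive (`q`) constant-impedance, constant-current
and constant-power parameters. -/
structure ZIPParams where
  Yp : ℝ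
  Ip : ℝ
  Pp : ℝ
  Yq : ℝ
  Iq : ℝ
  Pq : ℝ
  Yp_nonneg : 0 ≤ Yp
  Ip_nonneg : 0 ≤ Ip
  Pp_nonneg : 0 ≤ Pp
  Yq_nonneg : 0 ≤ Yq
  Iq_nonneg : 0 ≤ Iq
  Pq_nonneg : 0 ≤ Pq

/-- Parameters of an exponential load: nominal active and reactive powers, voltage indexes, and
the nominal voltage. -/
structure EXPParams where
  P0 : ℝ
  Q0 : ℝ
  np : ℝ
  nq : ℝ
  V0 : ℝ
  P0_nonneg : 0 ≤ P0
  Q0_nonneg : 0 ≤ Q0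
  np_nonneg : 0 ≤ np
  nq_nonneg : 0 ≤ nq
  V0_pos : 0 < V0

/-- A nonlinear static AC load. -/
inductive Load where
  | zip (p : ZIPParams)
  | exponential (p : EXPParams)

/-- The dq current drawn by a load at the dq voltage `V` (meaningful for `V ≠ 0`). -/
def Load.current : Load → (Fin 2 → ℝ) → (Fin 2 → ℝ)
  | .zip p, V =>
    ![(p.Pp * V 0 + p.Pq * V 1) / amplitude V ^ 2 + (p.Ip * V 0 + p.Iq * V 1) / amplitude V
        + p.Yp * V 0 + p.Yq * V 1,
      (p.Pp * V 1 - p.Pq * V 0) / amplitude V ^ 2 + (p.Ip * V 1 - p.Iq * V 0) / amplitude V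
        + p.Yp * V 1 - p.Yq * V 0]
  | .exponential p, V =>
    ![p.P0 * amplitude V ^ (p.np - 2) / p.V0 ^ p.np * V 0
        + p.Q0 * (amplitude V ^ (p.nq - 2) / p.V0 ^ p.nq) * V 1,
      p.P0 * amplitude V ^ (p.np - 2) / p.V0 ^ p.np * V 1
        - p.Q0 * (amplitude V ^ (p.nq - 2) / p.V0 ^ p.nq) * V 0]

/-- The parameter conditions for strict passivity of a load at the voltage amplitude `r`. -/
def Load.PassivityCondition : Load → ℝ → Prop
  | .zip p, r =>
    0 < p.Yp + p.Ip / (2 * r) ∧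
    1 / 4 * p.Iq ^ 2 * r ^ 2 + (p.Ip * p.Pp + p.Iq * p.Pq) * r + (p.Pp ^ 2 + p.Pq ^ 2)
      < p.Yp ^ 2 * r ^ 4 + p.Yp * p.Ip * r ^ 3
  | .exponential p, r =>
    0 < p.np * p.P0 ∧
    (p.nq - 2) ^ 2 * p.Q0 ^ 2 * (r / p.V0) ^ (2 * p.nq)
      < 4 * (p.np - 1) * p.P0 ^ 2 * (r / p.V0) ^ (2 * p.np)

/-- The current of an optional local load (`none`: no load). -/
def localCurrent : Option Load → (Fin 2 → ℝ) → (Fin 2 → ℝ)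
  | none, _ => 0
  | some ℓ, V => ℓ.current V

/-! ## Distributed generation units (DGUs) -/

/-- Resistance, inductance and capacitance of the filter of a DGU. -/
structure RLCFilter where
  Rt : ℝ
  Lt : ℝ
  Ct : ℝ
  Rt_pos : 0 < Rt
  Lt_pos : 0 < Lt
  Ct_pos : 0 < Ct

namespace RLCFilter

variable (F : RLCFilter)

/-- Interconnection matrix of the open-loop DGU. -/
def J (ω₀ : ℝ) : Matrix (Fin 4) (Fin 4) ℝ :=
  !![0, ω₀ * F.Lt, -1, 0;
     -(ω₀ * F.Lt), 0, 0, -1;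
     1, 0, 0, ω₀ * F.Ct;
     0, 1, -(ω₀ * F.Ct), 0]

/-- Damping matrix of the open-loop DGU. -/
def R : Matrix (Fin 4) (Fin 4) ℝ := Matrix.diagonal ![F.Rt, F.Rt, 0, 0]

/-- Energy matrix of the open-loop DGU; the Hamiltonian is `H x = ½ xᵀ Q x`, with gradient
(co-state) `Q x`. -/
def Q : Matrix (Fin 4) (Fin 4) ℝ :=
  Matrix.diagonal ![1 / F.Lt, 1 / F.Lt, 1 / F.Ct, 1 / F.Ct]

/-- Control input matrix. -/
def G : Matrix (Fin 4) (Fin 2) ℝ := !![1, 0; 0, 1; 0, 0; 0, 0]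

/-- Interaction matrix. -/
def K : Matrix (Fin 4) (Fin 2) ℝ := !![0, 0; 0, 0; 1, 0; 0, 1]

/-- Open-loop port-Hamiltonian dynamics of a DGU, with state
`x = (Lt Iᵈ, Lt I^q, Ct Vᵈ, Ct V^q)`, VSI voltage `u` and interaction input `d`. -/
def openLoop (ω₀ : ℝ) (x : Fin 4 → ℝ) (u d : Fin 2 → ℝ) : Fin 4 → ℝ :=
  (F.J ω₀ - F.R) *ᵥ (F.Q *ᵥ x) + G *ᵥ u + K *ᵥ d

/-- Interaction output of a DGU: its dq node voltage. -/
def output (x : Fin 4 → ℝ) : Fin 2 → ℝ := Kᵀ *ᵥ (F.Q *ᵥ x)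

end RLCFilter

/-- A DGU whose VSI is saturated. In each of the two components the VSI voltage is constant, at the
upper or the lower saturation limit. -/
structure SatDGU where
  filter : RLCFilter
  /-- saturation limits of the VSI voltage, d and q component -/
  Vsat : Fin 2 → ℝ
  Vsat_pos : ∀ a, 0 < Vsat a
  /-- the limit (upper or lower) at which each component is saturated -/
  sign : Fin 2 → ℤˣ
  localLoad : Option Load

namespace SatDGU

/-- The constant VSI voltage `(± Vsatᵈ, ± Vsat^q)` of a saturated DGU. -/
def input (D : SatDGU) : Fin 2 → ℝ := fun a => (((D.sign a : ℤˣ) : ℤ) : ℝ) * D.Vsat a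

/-- The port-Hamiltonian model of a saturated DGU: open-loop dynamics with constant control. -/
def phs (D : SatDGU) (ω₀ : ℝ) (x : Fin 4 → ℝ) (d : Fin 2 → ℝ) : Fin 4 → ℝ :=
  D.filter.openLoop ω₀ x D.input d

end SatDGU

/-- An unsaturated DGU with port-Hamiltonian control (interconnection and damping assignment) and
integral action. -/
structure PHSDGU where
  filter : RLCFilter
  α : Fin 2 → ℝ
  ν : Fin 2 → ℝ
  kI : Fin 2 → ℝ
  α_neg : ∀ a, α a < 0
  ν_pos : ∀ a, 0 < ν a
  kI_pos : ∀ a, 0 < kI a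
  /-- voltage reference -/
  Vref : Fin 2 → ℝ
  Vref_ne : Vref ≠ 0
  /-- constant offset of the transformed current states -/
  offset : Fin 2 → ℝ
  localLoad : Option Load

namespace PHSDGU

variable (D : PHSDGU)

/-- Interconnection matrix of the closed loop. -/
def J (ω₀ : ℝ) : Matrix (Fin 6) (Fin 6) ℝ :=
  !![0, 0, -D.ν 0, 0, 0, 0;
     0, 0, 0, -D.ν 1, 0, 0;
     D.ν 0, 0, 0, ω₀ * D.filter.Ct, -D.kI 0, 0;
     0, D.ν 1, -(ω₀ * D.filter.Ct), 0, 0, -D.kI 1;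
     0, 0, D.kI 0, 0, 0, 0;
     0, 0, 0, D.kI 1, 0, 0]

/-- Damping matrix of the closed loop. -/
def R : Matrix (Fin 6) (Fin 6) ℝ := Matrix.diagonal ![-D.α 0, -D.α 1, 0, 0, 0, 0]

/-- Energy matrix of the closed loop; the Hamiltonian is `½ (x - center)ᵀ Q (x - center)`. -/
def Q : Matrix (Fin 6) (Fin 6) ℝ :=
  Matrix.diagonal ![1 / (D.filter.Lt * D.ν 0), 1 / (D.filter.Lt * D.ν 1),
    1 / D.filter.Ct, 1 / D.filter.Ct, 1 / D.kI 0, 1 / D.kI 1]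

/-- Center of the closed-loop Hamiltonian. -/
def center : Fin 6 → ℝ :=
  ![D.offset 0, D.offset 1, D.filter.Ct * D.Vref 0, D.filter.Ct * D.Vref 1, 0, 0]

/-- Interaction matrix of the closed loop. -/
def K : Matrix (Fin 6) (Fin 2) ℝ := !![0, 0; 0, 0; 1, 0; 0, 1; 0, 0; 0, 0]

/-- Closed-loop dynamics; the state consists of the two transformed current states, the two
voltage states `Ct Vᵈ`, `Ct V^q`, and the two integrator states. -/
def closedLoop (ω₀ : ℝ) (x : Fin 6 → ℝ) (d : Fin 2 → ℝ) : Fin 6 → ℝ :=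
  (D.J ω₀ - D.R) *ᵥ (D.Q *ᵥ (x - D.center)) + K *ᵥ d

/-- Interaction output: the dq node voltage. -/
def output (x : Fin 6 → ℝ) : Fin 2 → ℝ := ![x 2 / D.filter.Ct, x 3 / D.filter.Ct]

end PHSDGU

/-- Index type of the state of a PI-controlled DGU: voltage states `Ct V`, current states `Lt I`,
integrator states. -/
abbrev PIIdx : Type := Fin 2 ⊕ (Fin 2 ⊕ Fin 2)

/-- An unsaturated DGU with multi-variable PI control: with the state `(Ct V, Lt I, v)` and the
integrator `v' = Vref - V`, the VSI voltage is `K11 V + K12 I + K13 v`. -/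
structure PIDGU where
  filter : RLCFilter
  K11 : Matrix (Fin 2) (Fin 2) ℝ
  K12 : Matrix (Fin 2) (Fin 2) ℝ
  K13 : Matrix (Fin 2) (Fin 2) ℝ
  /-- voltage reference -/
  Vref : Fin 2 → ℝ
  Vref_ne : Vref ≠ 0
  localLoad : Option Load

namespace PIDGU

variable (D : PIDGU)

/-- The closed-loop matrix of a PI-controlled DGU. -/
def F (ω₀ : ℝ) : Matrix PIIdx PIIdx ℝ :=
  Matrix.fromBlocks
    !![0, ω₀; -ω₀, 0]
    (Matrix.fromCols ((1 / D.filter.Lt) • (1 : Matrix (Fin 2) (Fin 2) ℝ)) 0)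
    (Matrix.fromRows (-((1 / D.filter.Ct) • (1 - D.K11)))
      (-((1 / D.filter.Ct) • (1 : Matrix (Fin 2) (Fin 2) ℝ))))
    (Matrix.fromBlocks
      (!![-(D.filter.Rt / D.filter.Lt), ω₀; -ω₀, -(D.filter.Rt / D.filter.Lt)]
        + (1 / D.filter.Lt) • D.K12)
      D.K13 0 0)

/-- Closed-loop dynamics of a PI-controlled DGU with interaction input `d`. -/
def closedLoop (ω₀ : ℝ) (x : PIIdx → ℝ) (d : Fin 2 → ℝ) : PIIdx → ℝ :=
  D.F ω₀ *ᵥ x + Sum.elim d (Sum.elim 0 D.Vref)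

/-- Interaction output: the dq node voltage. -/
def output (x : PIIdx → ℝ) : Fin 2 → ℝ := fun a => x (Sum.inl a) / D.filter.Ct

/-- Admissible gains: they stabilize the disconnected DGU (its closed-loop matrix is Hurwitz), and
the closed loop satisfies the dissipation inequality `Fᵀ P + P F ≤ 0` for some positive definite
`P = blockdiag(1, P22)`. -/
def Admissible (ω₀ : ℝ) : Prop :=
  (∀ μ ∈ spectrum ℂ ((D.F ω₀).map (algebraMap ℝ ℂ)), μ.re < 0) ∧
  ∃ P22 : Matrix (Fin 2 ⊕ Fin 2) (Fin 2 ⊕ Fin 2) ℝ, P22.PosDef ∧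
    (-((D.F ω₀)ᵀ * Matrix.fromBlocks 1 0 0 P22
      + Matrix.fromBlocks 1 0 0 P22 * D.F ω₀)).PosSemidef

end PIDGU

/-! ## Load nodes and power lines -/

/-- A lone-standing load node. -/
structure LoadNode where
  C : ℝ
  C_pos : 0 < C
  load : Load

namespace LoadNode

variable (N : LoadNode)

/-- Interaction output: the dq node voltage, i.e. the co-state `x / C`. -/
def output (x : Fin 2 → ℝ) : Fin 2 → ℝ := (1 / N.C) • x

/-- Dynamics of a load node with state `x = C V` and interaction input `d`. -/
def field (ω₀ : ℝ) (x d : Fin 2 → ℝ) : Fin 2 → ℝ :=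
  !![0, ω₀ * N.C; -(ω₀ * N.C), 0] *ᵥ N.output x - N.load.current (N.output x) + d

end LoadNode

/-- Parameters of a power line (the capacitive legs belong to the nodes). -/
structure Line where
  R : ℝ
  L : ℝ
  R_pos : 0 < R
  L_pos : 0 < L

namespace Line

variable (ℓ : Line)

/-- The dq line current, i.e. the co-state `x / L`. -/
def current (x : Fin 2 → ℝ) : Fin 2 → ℝ := (1 / ℓ.L) • x

/-- Dynamics of a line with state `x = L I` from a node with voltage `Va` to one with voltage
`Vb`. -/
def field (ω₀ : ℝ) (x Va Vb : Fin 2 → ℝ) : Fin 2 → ℝ :=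
  (!![0, ω₀ * ℓ.L; -(ω₀ * ℓ.L), 0] - Matrix.diagonal ![ℓ.R, ℓ.R]) *ᵥ ℓ.current x + (Va - Vb)

end Line

/-! ## The microgrid -/

/-- The nodes: saturated DGUs, unsaturated DGUs with port-Hamiltonian control, unsaturated DGUs with
PI control, lone-standing loads. -/
abbrev Node (Ds Dh Dp L : Type*) : Type _ := Ds ⊕ Dh ⊕ Dp ⊕ L

/-- An islanded AC microgrid with arbitrary topology. -/
structure Microgrid (Ds Dh Dp L P : Type*) where
  /-- reference frequency of the synchronized dq frames -/
  ω₀ : ℝ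
  ω₀_pos : 0 < ω₀
  sat : Ds → SatDGU
  phs : Dh → PHSDGU
  pi : Dp → PIDGU
  loadNode : L → LoadNode
  line : P → Line
  /-- the node at which a line starts (reference direction of its current) -/
  src : P → Node Ds Dh Dp L
  /-- the node at which a line ends -/
  dst : P → Node Ds Dh Dp L

/-- The state of the microgrid: the states of the saturated DGUs, of the unsaturated DGUs with
port-Hamiltonian and with PI control, of the load nodes, and of the lines. -/
abbrev State (Ds Dh Dp L P : Type*) : Type _ :=
  (Ds → Fin 4 → ℝ) × (Dh → Fin 6 → ℝ) × (Dp → PIIdx → ℝ) × (L → Fin 2 → ℝ) × (P → Fin 2 → ℝ)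

namespace Microgrid

variable {Ds Dh Dp L P : Type*} (mg : Microgrid Ds Dh Dp L P)

/-- The dq voltage of a node. -/
def voltage (x : State Ds Dh Dp L P) : Node Ds Dh Dp L → (Fin 2 → ℝ)
  | .inl i => (mg.sat i).filter.output (x.1 i)
  | .inr (.inl i) => (mg.phs i).output (x.2.1 i)
  | .inr (.inr (.inl i)) => (mg.pi i).output (x.2.2.1 i)
  | .inr (.inr (.inr j)) => (mg.loadNode j).output (x.2.2.2.1 j)

/-- The load at a node, if there is one. -/
def loadAt : Node Ds Dh Dp L → Option Load
  | .inl i => (mg.sat i).localLoad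
  | .inr (.inl i) => (mg.phs i).localLoad
  | .inr (.inr (.inl i)) => (mg.pi i).localLoad
  | .inr (.inr (.inr j)) => some (mg.loadNode j).load

open Classical in
/-- The interaction input of a node: the currents of the incoming lines minus those of the outgoing
lines. -/
def nodeInput [Fintype P] (x : State Ds Dh Dp L P) (k : Node Ds Dh Dp L) : Fin 2 → ℝ :=
  -(∑ l with mg.src l = k, (mg.line l).current (x.2.2.2.2 l))
    + ∑ l with mg.dst l = k, (mg.line l).current (x.2.2.2.2 l)

/-- The vector field of the interconnected microgrid. A local load at a DGU draws its current from
the node of that DGU. -/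
def field [Fintype P] (x : State Ds Dh Dp L P) : State Ds Dh Dp L P :=
  (fun i => (mg.sat i).phs mg.ω₀ (x.1 i)
      (mg.nodeInput x (.inl i)
        - localCurrent (mg.sat i).localLoad (mg.voltage x (.inl i))),
   fun i => (mg.phs i).closedLoop mg.ω₀ (x.2.1 i)
      (mg.nodeInput x (.inr (.inl i))
        - localCurrent (mg.phs i).localLoad (mg.voltage x (.inr (.inl i)))),
   fun i => (mg.pi i).closedLoop mg.ω₀ (x.2.2.1 i)
      (mg.nodeInput x (.inr (.inr (.inl i)))
        - localCurrent (mg.pi i).localLoad (mg.voltage x (.inr (.inr (.inl i))))),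
   fun j => (mg.loadNode j).field mg.ω₀ (x.2.2.2.1 j)
      (mg.nodeInput x (.inr (.inr (.inr j)))),
   fun l => (mg.line l).field mg.ω₀ (x.2.2.2.2 l)
      (mg.voltage x (mg.src l)) (mg.voltage x (mg.dst l)))

end Microgrid

end ImG

end

/-!
The stability claim is proved by Lyapunov's indirect method: the vector field of the microgrid is
`C¹` near `xbar`, because no node voltage vanishes there, so it suffices that its derivative at
`xbar` has no complex eigenvalue with nonnegative real part.

The energy of the subsystems gives that. Let `x + i y` be an eigenvector of the derivative for the
eigenvalue `a + i b` with `a ≥ 0`. By symmetry of the quadratic energy, the total power absorbed by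
`x` and by `y` is `a` times a nonnegative number (`storageForm_eigenpair_nonneg`). The
interconnection is lossless (`sum_voltage_dotProduct_nodeInput`), so that this power is also at most
minus the dissipation of `x` and `y` (`storageForm_linearization_le`), which is nonnegative, because
the passivity conditions make the derivatives of the load currents positive definite
(`polarCurrent_fderiv_pos`). Hence nothing is dissipated. This makes the line currents, the voltages
of all nodes with loads, the filter currents of the saturated DGUs and the damped states of the DGUs
with port-Hamiltonian control vanish; the eigenvector equation then forces the remaining states of
these subsystems to vanish too. What is left of the eigenvector at a PI-controlled DGU is an
eigenvector of its disconnected closed-loop matrix, which is Hurwitz, so it vanishes as well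
(`linearization_isHurwitz`).

For the indirect method, a Hurwitz matrix `A` needs a quadratic Lyapunov function. For small `h > 0`
the spectral radius of `B = 1 + h A` is less than one, so by Gelfand's formula
`P = ∑ₖ (Bᵏ)ᵀ Bᵏ` converges, and `Bᵀ P B - P = -1` yields `AᵀP + PA < 0`
(`Matrix.exists_lyapunov`). The Lyapunov function decays exponentially along solutions of the
nonlinear system near `xbar`; global solutions come from the Picard-Lindelöf theorem for the vector
field cut off outside a neighbourhood of `xbar`.

Equilibrium-independent passivity of a saturated DGU holds with the shifted energy as storage
function, since the open-loop model is affine in the state and the input (`SatDGU.isEIP`).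
-/

/-! ### Lyapunov functions of Hurwitz matrices -/

section MatrixLyapunov

open Filter
open scoped Matrix.Norms.Frobenius ENNReal Pointwise

variable {n : Type*} [Fintype n] [DecidableEq n]

/-- Gelfand's formula as geometric decay of the powers. -/
theorem eventually_norm_pow_le_of_spectralRadius_lt {A : Type*} [NormedRing A] [NormedAlgebra ℂ A]
    [CompleteSpace A] (a : A) (h : spectralRadius ℂ a < 1) :
    ∃ r : ℝ, 0 ≤ r ∧ r < 1 ∧ ∀ᶠ k : ℕ in atTop, ‖a ^ k‖ ≤ r ^ k := by
  obtain ⟨r, hr, hr1⟩ := ENNReal.lt_iff_exists_nnreal_btwn.1 h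
  refine ⟨r, r.2, by exact_mod_cast hr1, ?_⟩
  have hlim := spectrum.pow_nnnorm_pow_one_div_tendsto_nhds_spectralRadius a
  filter_upwards [hlim.eventually_lt_const hr, eventually_gt_atTop 0] with k hk hk0
  have h1 := (ENNReal.rpow_le_rpow hk.le (Nat.cast_nonneg (α := ℝ) k))
  rw [← ENNReal.rpow_mul, one_div_mul_cancel (by positivity), ENNReal.rpow_one,
    ENNReal.rpow_natCast] at h1
  exact_mod_cast h1

theorem Matrix.exists_spectralRadius_one_add_smul_lt_one (A : Matrix n n ℂ)
    (hA : ∀ μ ∈ spectrum ℂ A, μ.re < 0) :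
    ∃ h : ℝ, 0 < h ∧ spectralRadius ℂ (1 + (h : ℂ) • A) < 1 := by
  -- `|1 + h μ|² = 1 + h (2 Re μ + h |μ|²)`, and the bracket is negative for small `h > 0`.
  have key : ∀ μ : ℂ, μ.re < 0 → ∀ᶠ h : ℝ in 𝓝[>] 0, ‖1 + (h : ℂ) * μ‖₊ < 1 := by
    intro μ hμ
    have hc : ∀ᶠ h : ℝ in 𝓝[>] 0, 2 * μ.re + h * (μ.re ^ 2 + μ.im ^ 2) < 0 := by
      have : Tendsto (fun h : ℝ => 2 * μ.re + h * (μ.re ^ 2 + μ.im ^ 2)) (𝓝[>] 0)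
          (𝓝 (2 * μ.re + 0 * (μ.re ^ 2 + μ.im ^ 2))) :=
        Tendsto.mono_left (Continuous.tendsto (by fun_prop) 0) nhdsWithin_le_nhds
      exact this.eventually_lt_const (by linarith)
    filter_upwards [hc, self_mem_nhdsWithin] with h h1 h2
    have h2 : 0 < h := h2
    rw [← NNReal.coe_lt_coe, coe_nnnorm, NNReal.coe_one, ← sq_lt_one_iff₀ (norm_nonneg _),
      ← Complex.normSq_eq_norm_sq, Complex.normSq_apply]
    simp
    nlinarith
  have hfin := (Matrix.finite_spectrum A)
  have hall := (eventually_all_finite hfin).2 (fun μ hμ => key μ (hA μ hμ))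
  obtain ⟨h, hh, hh0⟩ := (hall.and self_mem_nhdsWithin).exists
  have hh0 : 0 < h := hh0
  refine ⟨h, hh0, ?_⟩
  cases isEmpty_or_nonempty n
  · simp
  have hspec : spectrum ℂ (1 + (h : ℂ) • A) = {1} + (h : ℂ) • spectrum ℂ A := by
    rw [← spectrum.smul_eq_smul _ _ (spectrum.nonempty A), spectrum.singleton_add_eq, map_one]
  have := spectrum.spectralRadius_lt_of_forall_lt (1 + (h : ℂ) • A) (r := 1) (fun z hz => by
    rw [hspec] at hz
    obtain ⟨_, rfl, _, ⟨y, hy, rfl⟩, rfl⟩ := Set.mem_add.1 hz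
    simpa using hh y hy)
  simpa using this

/-- **Lyapunov's theorem**: a Hurwitz matrix has a quadratic Lyapunov function, here bounded below
by the squared Euclidean norm. -/
theorem Matrix.exists_lyapunov (A : Matrix n n ℝ)
    (hA : ∀ μ ∈ spectrum ℂ (A.map (algebraMap ℝ ℂ)), μ.re < 0) :
    ∃ P : Matrix n n ℝ, Pᵀ = P ∧ (∀ x, x ⬝ᵥ x ≤ x ⬝ᵥ P *ᵥ x) ∧
      ∃ c > 0, ∀ x, x ⬝ᵥ P *ᵥ (A *ᵥ x) ≤ -c * (x ⬝ᵥ x) := by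
  obtain ⟨h, h0, hh⟩ := Matrix.exists_spectralRadius_one_add_smul_lt_one _ hA
  set B : Matrix n n ℝ := 1 + h • A with hB
  have hmap : (1 + (h : ℂ) • A.map (algebraMap ℝ ℂ)) = (algebraMap ℝ ℂ).mapMatrix B := by
    ext i j
    simp [hB, Matrix.one_apply]
    split_ifs <;> simp
  rw [hmap] at hh
  obtain ⟨r, hr0, hr1, hr⟩ := eventually_norm_pow_le_of_spectralRadius_lt _ hh
  have hnorm : ∀ k, ‖((algebraMap ℝ ℂ).mapMatrix B) ^ k‖ = ‖B ^ k‖ := by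
    intro k
    rw [← map_pow]
    exact Matrix.frobenius_norm_map_eq _ _ (fun a => by simp)
  simp_rw [hnorm] at hr
  have hsum : Summable fun k => (B ^ k)ᵀ * B ^ k := by
    refine Summable.of_norm_bounded_eventually_nat (g := fun k => (r ^ 2) ^ k)
      (summable_geometric_of_lt_one (by positivity) (by nlinarith)) ?_
    filter_upwards [hr] with k hk
    calc ‖(B ^ k)ᵀ * B ^ k‖ ≤ ‖(B ^ k)ᵀ‖ * ‖B ^ k‖ := norm_mul_le _ _
      _ = ‖B ^ k‖ * ‖B ^ k‖ := by rw [Matrix.frobenius_norm_transpose]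
      _ ≤ r ^ k * r ^ k := by gcongr
      _ = (r ^ 2) ^ k := by rw [← mul_pow, sq]
  set P := ∑' k, (B ^ k)ᵀ * B ^ k with hP
  have hq : ∀ x : n → ℝ, HasSum (fun k => (B ^ k *ᵥ x) ⬝ᵥ (B ^ k *ᵥ x)) (x ⬝ᵥ P *ᵥ x) := by
    intro x
    have hcont : Continuous fun M : Matrix n n ℝ => x ⬝ᵥ M *ᵥ x := by fun_prop
    let φ : Matrix n n ℝ →+ ℝ :=
      { toFun := fun M => x ⬝ᵥ M *ᵥ x
        map_zero' := by simp
        map_add' := fun M N => by simp [Matrix.add_mulVec] }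
    convert! hsum.hasSum.map φ hcont using 1
    ext k
    change _ = x ⬝ᵥ ((B ^ k)ᵀ * B ^ k) *ᵥ x
    rw [← Matrix.mulVec_mulVec, Matrix.dotProduct_mulVec x, Matrix.vecMul_transpose]
  have hsymm : Pᵀ = P := by
    rw [hP, Matrix.transpose_tsum]
    simp [Matrix.transpose_mul]
  refine ⟨P, hsymm, ?_, ?_⟩
  · intro x
    have := (hq x).summable.le_tsum 0 (fun k _ => by
      simpa using dotProduct_self_star_nonneg (B ^ k *ᵥ x))
    rw [(hq x).tsum_eq] at this
    simpa using this
  · have hstep : ∀ x, x ⬝ᵥ P *ᵥ x = x ⬝ᵥ x + (B *ᵥ x) ⬝ᵥ P *ᵥ (B *ᵥ x) := by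
      intro x
      have h1 := (hq x).summable.tsum_eq_zero_add
      rw [(hq x).tsum_eq] at h1
      have h2 := (hq (B *ᵥ x)).tsum_eq
      simp only [Matrix.mulVec_mulVec, ← pow_succ] at h2
      rw [h1, h2]
      simp
    -- Expanding `hstep` with `B = 1 + h A` gives `2h xᵀPAx + h² (Ax)ᵀP(Ax) = -xᵀx`.
    refine ⟨1 / (2 * h), by positivity, fun x => ?_⟩
    have h1 := hstep x
    have hcomm : (A *ᵥ x) ⬝ᵥ P *ᵥ x = x ⬝ᵥ P *ᵥ (A *ᵥ x) := by
      rw [dotProduct_comm, ← hsymm, Matrix.mulVec_transpose, ← Matrix.dotProduct_mulVec, hsymm]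
    have hpos : 0 ≤ (A *ᵥ x) ⬝ᵥ P *ᵥ (A *ᵥ x) :=
      (hq _).nonneg fun k => by simpa using dotProduct_self_star_nonneg (B ^ k *ᵥ (A *ᵥ x))
    simp only [hB, Matrix.add_mulVec, Matrix.one_mulVec, Matrix.smul_mulVec, Matrix.mulVec_add,
      Matrix.mulVec_smul, add_dotProduct, dotProduct_add, smul_dotProduct, dotProduct_smul,
      smul_eq_mul, hcomm] at h1
    have h2 : 2 * h * (x ⬝ᵥ P *ᵥ (A *ᵥ x)) ≤ -(x ⬝ᵥ x) := by
      nlinarith [mul_nonneg h0.le (mul_nonneg h0.le hpos)]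
    rw [neg_mul, one_div_mul_eq_div, ← neg_div, le_div_iff₀ (by positivity)]
    linarith

end MatrixLyapunov

/-! ### Quadratic Lyapunov functions -/

namespace Matrix

variable {n : Type*} [Fintype n] [DecidableEq n]

/-- Complex eigenvectors of a real matrix, in terms of their real and imaginary parts. -/
theorem mem_spectrum_map_ofReal_iff (A : Matrix n n ℝ) (μ : ℂ) :
    μ ∈ spectrum ℂ (A.map (algebraMap ℝ ℂ)) ↔ ∃ x y : n → ℝ, (x ≠ 0 ∨ y ≠ 0) ∧
      A *ᵥ x = μ.re • x - μ.im • y ∧ A *ᵥ y = μ.im • x + μ.re • y := by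
  have hre : ∀ v : n → ℂ, ∀ i, ((A.map (algebraMap ℝ ℂ) *ᵥ v) i).re =
      (A *ᵥ fun j => (v j).re) i := by
    intro v i
    simp [Matrix.mulVec, dotProduct]
  have him : ∀ v : n → ℂ, ∀ i, ((A.map (algebraMap ℝ ℂ) *ᵥ v) i).im =
      (A *ᵥ fun j => (v j).im) i := by
    intro v i
    simp [Matrix.mulVec, dotProduct]
  rw [← Matrix.spectrum_toLin', ← Module.End.hasEigenvalue_iff_mem_spectrum]
  constructor
  · intro h
    obtain ⟨v, hv⟩ := h.exists_hasEigenvector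
    have hv1 := hv.apply_eq_smul
    rw [Matrix.toLin'_apply] at hv1
    refine ⟨fun i => (v i).re, fun i => (v i).im, ?_, ?_, ?_⟩
    · by_contra! hc
      refine hv.2 (funext fun i => Complex.ext ?_ ?_)
      · exact congrFun hc.1 i
      · exact congrFun hc.2 i
    · ext i
      rw [← hre, hv1]
      simp
    · ext i
      rw [← him, hv1]
      simp
      ring
  · rintro ⟨x, y, hxy, hx, hy⟩
    refine Module.End.hasEigenvalue_of_hasEigenvector (x := fun i => (⟨x i, y i⟩ : ℂ)) ⟨?_, ?_⟩
    · rw [Module.End.mem_eigenspace_iff, Matrix.toLin'_apply]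
      ext i
      apply Complex.ext
      · rw [hre]; simp [hx]
      · rw [him]; simp [hy]; ring
    · intro hc
      have hx0 : x = 0 := funext fun i => by simpa using congrArg Complex.re (congrFun hc i)
      have hy0 : y = 0 := funext fun i => by simpa using congrArg Complex.im (congrFun hc i)
      simp [hx0, hy0] at hxy

end Matrix

section Lyapunov

variable {E : Type*} [NormedAddCommGroup E] [NormedSpace ℝ E]

/-- A real operator is Hurwitz if its complexification has no eigenvalue `a + i b` with `a ≥ 0`; an
eigenvector `x + i y` is given by its real and imaginary parts. -/
def ContinuousLinearMap.IsHurwitz (A : E →L[ℝ] E) : Prop :=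
  ∀ (a b : ℝ) (x y : E), 0 ≤ a → A x = a • x - b • y → A y = b • x + a • y → x = 0 ∧ y = 0

/-- `x ↦ β (x - xbar) (x - xbar)` is a strict Lyapunov function of `x' = f x` on `s`: the symmetric
form `β` is positive definite with lower bound `m`, and half of the derivative along solutions is at
most `-κ` times the function. -/
structure IsQuadraticLyapunov (β : E →L[ℝ] E →L[ℝ] ℝ) (f : E → E) (xbar : E) (s : Set E)
    (m κ : ℝ) : Prop where
  symm : ∀ x y, β x y = β y x
  m_pos : 0 < m
  κ_pos : 0 < κ
  lower : ∀ x, m * ‖x‖ ^ 2 ≤ β x x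
  decay : ∀ x ∈ s, β (x - xbar) (f x) ≤ -κ * β (x - xbar) (x - xbar)

theorem ContinuousLinearMap.IsHurwitz.exists_lyapunov [FiniteDimensional ℝ E] {A : E →L[ℝ] E}
    (hA : A.IsHurwitz) :
    ∃ (β : E →L[ℝ] E →L[ℝ] ℝ) (m κ : ℝ), IsQuadraticLyapunov β A 0 Set.univ m κ := by
  classical
  let b := Module.finBasis ℝ E
  let e : E ≃L[ℝ] (Fin (Module.finrank ℝ E) → ℝ) := b.equivFun.toContinuousLinearEquiv
  let M := LinearMap.toMatrix b b A.toLinearMap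
  have heA : ∀ x, e (A x) = M *ᵥ e x := fun x =>
    (LinearMap.toMatrix_mulVec_repr b b A.toLinearMap x).symm
  have heA' : ∀ x, A (e.symm x) = e.symm (M *ᵥ x) := fun x => by
    rw [e.eq_symm_apply, heA, e.apply_symm_apply]
  obtain ⟨P, hPs, hP1, c, hc, hP2⟩ := M.exists_lyapunov (fun μ hμ => by
    by_contra! hre
    obtain ⟨x, y, hxy, hx, hy⟩ := (M.mem_spectrum_map_ofReal_iff μ).1 hμ
    have := hA μ.re μ.im (e.symm x) (e.symm y) hre (by rw [heA', hx]; simp) (by rw [heA', hy]; simp)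
    simp at this
    simp [this.1, this.2] at hxy)
  let β : E →L[ℝ] E →L[ℝ] ℝ := LinearMap.toContinuousBilinearMap
    ((Matrix.toLinearMap₂' ℝ P).compl₁₂ e.toLinearMap e.toLinearMap)
  have hβ : ∀ x y, β x y = e x ⬝ᵥ P *ᵥ e y := fun x y => by
    simp [β, Matrix.toLinearMap₂'_apply']
  obtain ⟨K, hK0, hK⟩ : ∃ K : ℝ, 0 < K ∧ ∀ x, ‖x‖ ≤ K * ‖e x‖ := by
    refine ⟨‖e.symm.toContinuousLinearMap‖ + 1, by positivity, fun x => ?_⟩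
    have := e.symm.toContinuousLinearMap.le_opNorm (e x)
    rw [ContinuousLinearEquiv.coe_coe, e.symm_apply_apply] at this
    nlinarith [norm_nonneg (e x)]
  have hdot : ∀ v : Fin (Module.finrank ℝ E) → ℝ, ‖v‖ ^ 2 ≤ v ⬝ᵥ v := by
    intro v
    have h0 : 0 ≤ v ⬝ᵥ v := by simpa using dotProduct_self_star_nonneg v
    refine (Real.le_sqrt (norm_nonneg _) h0).1
      ((pi_norm_le_iff_of_nonneg (by positivity)).2 fun i => ?_)
    refine Real.abs_le_sqrt ?_
    rw [sq]
    exact Finset.single_le_sum (f := fun i => v i * v i) (fun i _ => mul_self_nonneg _)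
      (Finset.mem_univ i)
  have hlow : ∀ x, (K ^ 2)⁻¹ * ‖x‖ ^ 2 ≤ e x ⬝ᵥ e x := fun x => by
    refine le_trans ?_ (hdot (e x))
    rw [inv_mul_le_iff₀ (by positivity), ← mul_pow]
    exact pow_le_pow_left₀ (norm_nonneg _) (hK x) 2
  refine ⟨β, (K ^ 2)⁻¹, c * ((K ^ 2)⁻¹ / (‖β‖ + 1)), ?_, by positivity, by positivity, ?_, ?_⟩
  · intro x y
    rw [hβ, hβ, dotProduct_comm, ← hPs, Matrix.mulVec_transpose, ← Matrix.dotProduct_mulVec, hPs]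
  · intro x
    rw [hβ]
    exact (hlow x).trans (hP1 _)
  · intro x _
    rw [sub_zero, hβ x (A x), heA]
    refine (hP2 _).trans ?_
    have h1 : β x x ≤ (‖β‖ + 1) * ‖x‖ ^ 2 := by
      have := (le_abs_self _).trans (β.le_opNorm₂ x x)
      nlinarith [sq_nonneg ‖x‖]
    have h2 : (K ^ 2)⁻¹ / (‖β‖ + 1) * β x x ≤ e x ⬝ᵥ e x := by
      refine le_trans ?_ (hlow x)
      rw [div_mul_eq_mul_div, mul_div_assoc]
      gcongr
      rw [div_le_iff₀ (by positivity)]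
      linarith
    nlinarith

/-- A Lyapunov function of the derivative at an equilibrium is one of the nonlinear system near the
equilibrium, with half of the decay rate. -/
theorem IsQuadraticLyapunov.exists_of_hasFDerivAt {β : E →L[ℝ] E →L[ℝ] ℝ} {A : E →L[ℝ] E} {m κ : ℝ}
    (h : IsQuadraticLyapunov β A 0 Set.univ m κ) {f : E → E} {xbar : E} (h0 : f xbar = 0)
    (hf : HasFDerivAt f A xbar) :
    ∃ r > 0, IsQuadraticLyapunov β f xbar (Metric.ball xbar r) m (κ / 2) := by
  have hε : 0 < κ / 2 * m / (‖β‖ + 1) := by have := h.m_pos; have := h.κ_pos; positivity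
  obtain ⟨r, hr, hr'⟩ := Metric.eventually_nhds_iff.1 (hf.isLittleO.bound hε)
  refine ⟨r, hr, h.symm, h.m_pos, half_pos h.κ_pos, h.lower, fun x hx => ?_⟩
  have h1 := hr' hx
  rw [h0, sub_zero] at h1
  set y := x - xbar
  have h2 : β y (f x) = β y (A y) + β y (f x - A y) := by rw [← map_add]; simp
  have h3 := h.decay y trivial
  rw [sub_zero] at h3
  have h4 : β y (f x - A y) ≤ κ / 2 * β y y := calc
    β y (f x - A y) ≤ ‖β‖ * ‖y‖ * ‖f x - A y‖ := (le_abs_self _).trans (β.le_opNorm₂ _ _)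
    _ ≤ (‖β‖ + 1) * ‖y‖ * (κ / 2 * m / (‖β‖ + 1) * ‖y‖) := by gcongr; linarith
    _ = κ / 2 * (m * ‖y‖ ^ 2) := by field_simp
    _ ≤ κ / 2 * β y y := by have := h.κ_pos; gcongr; exact h.lower y
  rw [h2]
  linarith

/-- Exponential decay of the Lyapunov function along solutions that start in a sublevel set inside
the ball. -/
theorem IsQuadraticLyapunov.le_exp {β : E →L[ℝ] E →L[ℝ] ℝ} {f : E → E} {xbar : E} {r m κ : ℝ}
    (h : IsQuadraticLyapunov β f xbar (Metric.ball xbar r) m κ) (hr : 0 ≤ r) {T : ℝ} {x : ℝ → E}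
    (hx : ImG.IsSolutionOn f (Set.Icc 0 T) x) {c : ℝ} (hc0 : 0 < c) (hc : c < m * r ^ 2)
    (hx0 : β (x 0 - xbar) (x 0 - xbar) ≤ c) :
    ∀ t ∈ Set.Icc 0 T, β (x t - xbar) (x t - xbar) ≤ c * Real.exp (-κ * t) := by
  have hd : ∀ s t, HasDerivWithinAt x (f (x t)) s t →
      HasDerivWithinAt (fun t => β (x t - xbar) (x t - xbar))
        (2 * β (x t - xbar) (f (x t))) s t := by
    intro s t ht
    have h1 := ht.sub_const xbar
    have h2 := (β.hasFDerivAt.comp_hasDerivWithinAt t h1).clm_apply h1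
    rwa [h.symm (f (x t)), Function.comp_apply, ← two_mul] at h2
  -- Fencing: where the Lyapunov function meets `c exp (-κ t)`, it is at most `c`, so the solution
  -- is in the ball there, and the function decreases at the rate `2 κ`, faster than the fence.
  refine image_le_of_deriv_right_lt_deriv_boundary
    (fun t ht => (hd _ t (hx t ht)).continuousWithinAt)
    (fun t ht => hd _ t ((hx t (Set.Ico_subset_Icc_self ht)).mono_of_mem_nhdsWithin
      (Icc_mem_nhdsGE_of_mem ht))) (by simpa using hx0)
    (B' := fun t => c * (Real.exp (-κ * t) * -κ)) (fun t => ?_) (fun t ht heq => ?_)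
  · have := (((hasDerivAt_id t).const_mul (-κ)).exp).const_mul c
    simpa using this
  · have hB : 0 < c * Real.exp (-κ * t) := by positivity
    have hle : c * Real.exp (-κ * t) ≤ c := by
      have : Real.exp (-κ * t) ≤ 1 := Real.exp_le_one_iff.2 (by nlinarith [h.κ_pos, ht.1])
      nlinarith
    have hmem : x t ∈ Metric.ball xbar r := by
      rw [mem_ball_iff_norm]
      have := h.lower (x t - xbar)
      refine lt_of_pow_lt_pow_left₀ 2 hr ?_
      have hm := h.m_pos
      by_contra! hcon
      nlinarith [mul_le_mul_of_nonneg_left hcon hm.le]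
    have := h.decay _ hmem
    nlinarith [h.κ_pos, mul_pos h.κ_pos hB]

end Lyapunov

/-! ### Global solutions and Lyapunov's indirect method -/

section Existence

open ImG Set
open scoped NNReal

variable {E : Type*} [NormedAddCommGroup E] [NormedSpace ℝ E]

theorem ImG.IsSolutionOn.mono {f : E → E} {I J : Set ℝ} {x : ℝ → E} (h : IsSolutionOn f J x)
    (hIJ : I ⊆ J) : IsSolutionOn f I x :=
  fun t ht => (h t (hIJ ht)).mono hIJ

/-- A bounded, globally Lipschitz vector field has solutions on every time interval: the ball of
radius `M T` cannot be left up to the time `T`. -/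
theorem exists_isSolutionOn_Icc [CompleteSpace E] {f : E → E} {K M : ℝ≥0} (hf : LipschitzWith K f)
    (hM : ∀ x, ‖f x‖ ≤ M) (x₀ : E) (T : ℝ≥0) :
    ∃ x : ℝ → E, x 0 = x₀ ∧ IsSolutionOn f (Icc 0 (T : ℝ)) x := by
  have h0 : (0 : ℝ) ∈ Icc (0 : ℝ) T := left_mem_Icc.2 T.2
  have hPL : IsPicardLindelof (fun _ : ℝ => f) (⟨0, h0⟩ : Icc (0 : ℝ) T) x₀ (M * T) 0 M K :=
    { lipschitzOnWith := fun t _ => hf.lipschitzOnWith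
      continuousOn := fun x _ => continuousOn_const
      norm_le := fun t _ x _ => hM x
      mul_max_le := by simp }
  exact hPL.exists_eq_forall_mem_Icc_hasDerivWithinAt₀

/-- The solutions on the intervals `[0, n]` agree by uniqueness, so they glue to a solution on
`[0, ∞)`. -/
theorem exists_isSolutionOn_Ici [CompleteSpace E] {f : E → E} {K M : ℝ≥0} (hf : LipschitzWith K f)
    (hM : ∀ x, ‖f x‖ ≤ M) (x₀ : E) : ∃ x : ℝ → E, x 0 = x₀ ∧ IsSolutionOn f (Ici 0) x := by
  have hloc : ∀ n : ℕ, ∃ x : ℝ → E, x 0 = x₀ ∧ IsSolutionOn f (Icc 0 (n : ℝ)) x :=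
    fun n => by simpa using exists_isSolutionOn_Icc hf hM x₀ n
  choose x hx0 hx using hloc
  have huniq : ∀ m n : ℕ, m ≤ n → EqOn (x m) (x n) (Icc 0 (m : ℝ)) := by
    intro m n hmn
    have hxn : IsSolutionOn f (Icc 0 (m : ℝ)) (x n) :=
      (hx n).mono (Icc_subset_Icc_right (by exact_mod_cast hmn))
    have hr : ∀ y : ℝ → E, IsSolutionOn f (Icc 0 (m : ℝ)) y →
        ∀ t ∈ Ico 0 (m : ℝ), HasDerivWithinAt y (f (y t)) (Ici t) t := fun y hy t ht =>
      (hy t (Ico_subset_Icc_self ht)).mono_of_mem_nhdsWithin (Icc_mem_nhdsGE_of_mem ht)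
    exact ODE_solution_unique_of_mem_Icc_right (v := fun _ => f) (s := fun _ => univ)
      (fun t _ => hf.lipschitzOnWith)
      (fun t ht => (hx m t ht).continuousWithinAt) (hr _ (hx m)) (fun _ _ => mem_univ _)
      (fun t ht => (hxn t ht).continuousWithinAt) (hr _ hxn) (fun _ _ => mem_univ _)
      (by rw [hx0, hx0])
  refine ⟨fun t => x (⌊t⌋₊ + 1) t, hx0 (⌊(0 : ℝ)⌋₊ + 1), fun t ht => ?_⟩
  have ht : 0 ≤ t := ht
  have hlt : ∀ s : ℝ, s < ((⌊s⌋₊ + 1 : ℕ) : ℝ) := fun s => by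
    push_cast; exact Nat.lt_floor_add_one s
  have heq : ∀ s ∈ Ici (0 : ℝ) ∩ Iio ((⌊t⌋₊ + 1 : ℕ) : ℝ), x (⌊s⌋₊ + 1) s = x (⌊t⌋₊ + 1) s := by
    rintro s ⟨hs0, hs⟩
    have h0 : ⌊s⌋₊ ≤ ⌊t⌋₊ := Nat.lt_succ_iff.1 ((Nat.floor_lt hs0).2 hs)
    exact huniq _ _ (by omega) ⟨hs0, (hlt s).le⟩
  have hnhds : Ici (0 : ℝ) ∩ Iio ((⌊t⌋₊ + 1 : ℕ) : ℝ) ∈ 𝓝[Ici 0] t :=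
    inter_mem_nhdsWithin _ (Iio_mem_nhds (hlt t))
  have h1 := hx (⌊t⌋₊ + 1) t ⟨ht, (hlt t).le⟩
  have hIcc : Icc (0 : ℝ) ((⌊t⌋₊ + 1 : ℕ) : ℝ) ∈ 𝓝[Ici 0] t :=
    Filter.mem_of_superset hnhds fun s hs => ⟨hs.1, le_of_lt hs.2⟩
  have h2 : HasDerivWithinAt (x (⌊t⌋₊ + 1)) (f (x (⌊t⌋₊ + 1) t)) (Ici 0) t :=
    h1.mono_of_mem_nhdsWithin hIcc
  exact h2.congr_of_eventuallyEq (Filter.mem_of_superset hnhds heq) (heq t ⟨ht, hlt t⟩)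

/-- Multiplication with a bump function makes a locally `C¹` vector field globally Lipschitz and
bounded, without a change near `xbar`. -/
theorem exists_lipschitz_bounded_eqOn_ball [FiniteDimensional ℝ E] {f : E → E} {xbar : E}
    (hf : ContDiffAt ℝ 1 f xbar) :
    ∃ (g : E → E) (K M : ℝ≥0) (r : ℝ), 0 < r ∧ LipschitzWith K g ∧ (∀ x, ‖g x‖ ≤ M) ∧
      EqOn g f (Metric.ball xbar r) := by
  obtain ⟨ρ, hρ, hball⟩ := Metric.eventually_nhds_iff.1 (hf.eventually (by simp))
  let φ : ContDiffBump xbar := ⟨ρ / 3, ρ / 2, by positivity, by linarith⟩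
  have hsupp : HasCompactSupport fun x => φ x • f x := φ.hasCompactSupport.smul_right
  have hcd : ContDiff ℝ 1 fun x => φ x • f x := by
    rw [contDiff_iff_contDiffAt]
    intro x
    by_cases hx : dist x xbar < ρ
    · exact φ.contDiffAt.smul (hball hx)
    · refine contDiffAt_const (c := (0 : E)) |>.congr_of_eventuallyEq ?_
      have : (Metric.closedBall xbar (ρ / 2))ᶜ ∈ 𝓝 x :=
        Metric.isClosed_closedBall.isOpen_compl.mem_nhds (by simp; linarith)
      filter_upwards [this] with y hy
      have hy' : ρ / 2 < dist y xbar := by simpa using hy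
      rw [φ.zero_of_le_dist hy'.le, zero_smul]
  obtain ⟨K, hK⟩ := hcd.lipschitzWith_of_hasCompactSupport hsupp (by simp)
  obtain ⟨M, hM⟩ := hcd.continuous.bounded_above_of_compact_support hsupp
  refine ⟨_, K, M.toNNReal, ρ / 3, by positivity, hK,
    fun x => (hM x).trans (Real.le_coe_toNNReal M), fun x hx => ?_⟩
  simp [φ.one_of_mem_closedBall (Metric.ball_subset_closedBall hx)]

end Existence

section IndirectMethod

open ImG Set

variable {E : Type*} [NormedAddCommGroup E] [NormedSpace ℝ E]

theorem IsQuadraticLyapunov.mono {β : E →L[ℝ] E →L[ℝ] ℝ} {f g : E → E} {xbar : E} {s t : Set E}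
    {m κ : ℝ} (h : IsQuadraticLyapunov β f xbar s m κ) (hst : t ⊆ s) (hfg : EqOn g f t) :
    IsQuadraticLyapunov β g xbar t m κ :=
  ⟨h.symm, h.m_pos, h.κ_pos, h.lower, fun x hx => by rw [hfg hx]; exact h.decay x (hst hx)⟩

theorem IsQuadraticLyapunov.exists_dist_le {β : E →L[ℝ] E →L[ℝ] ℝ} {f : E → E} {xbar : E}
    {r m κ : ℝ} (h : IsQuadraticLyapunov β f xbar (Metric.ball xbar r) m κ) (hr : 0 < r)
    {ε : ℝ} (hε : 0 < ε) :
    ∃ δ > 0, ∀ (T : ℝ) (x : ℝ → E), IsSolutionOn f (Icc 0 T) x → dist (x 0) xbar < δ →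
      ∀ t ∈ Icc 0 T, dist (x t) xbar < ε * Real.exp (-(κ / 2) * t) := by
  have hm := h.m_pos
  set ε' := min ε r
  have hε' : 0 < ε' := lt_min hε hr
  have hcont : Filter.Tendsto (fun y : E => β (y - xbar) (y - xbar)) (𝓝 xbar) (𝓝 0) := by
    have : Continuous fun y : E => β (y - xbar) (y - xbar) := by fun_prop
    simpa using this.tendsto xbar
  have hc : 0 < m * ε' ^ 2 / 2 := by positivity
  obtain ⟨δ, hδ, hδ'⟩ := Metric.eventually_nhds_iff.1 (hcont.eventually_lt_const hc)
  refine ⟨δ, hδ, fun T x hx hx0 t ht => ?_⟩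
  have h1 := h.le_exp hr.le hx hc (by
    have : ε' ^ 2 ≤ r ^ 2 := pow_le_pow_left₀ hε'.le (min_le_right _ _) 2
    nlinarith) (hδ' hx0).le t ht
  have h2 := h.lower (x t - xbar)
  have h3 : ε' ^ 2 ≤ ε ^ 2 := pow_le_pow_left₀ hε'.le (min_le_left _ _) 2
  -- The Lyapunov function is quadratic, so the distance decays at half its rate.
  have h4 : Real.exp (-κ * t) = Real.exp (-(κ / 2) * t) ^ 2 := by
    rw [← Real.exp_nat_mul]; congr 1; push_cast; ring
  have h5 : 0 < Real.exp (-(κ / 2) * t) := Real.exp_pos _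
  rw [dist_eq_norm]
  refine lt_of_pow_lt_pow_left₀ 2 (by positivity) ?_
  rw [h4] at h1
  have h6 : m * ‖x t - xbar‖ ^ 2 < m * (ε * Real.exp (-(κ / 2) * t)) ^ 2 := by
    rw [mul_pow]
    have : 0 < Real.exp (-(κ / 2) * t) ^ 2 := by positivity
    calc _ ≤ m * ε' ^ 2 / 2 * Real.exp (-(κ / 2) * t) ^ 2 := h2.trans h1
      _ < m * ε' ^ 2 * Real.exp (-(κ / 2) * t) ^ 2 := by gcongr; linarith
      _ ≤ m * ε ^ 2 * Real.exp (-(κ / 2) * t) ^ 2 := by gcongr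
      _ = _ := by ring
  exact lt_of_mul_lt_mul_left h6 hm.le

/-- **Lyapunov's indirect method**: an equilibrium at which the derivative of the vector field is
Hurwitz is asymptotically stable. -/
theorem isAsymptoticallyStable_of_isHurwitz [FiniteDimensional ℝ E] {f : E → E} {A : E →L[ℝ] E}
    {xbar : E} (h0 : f xbar = 0) (hf : ContDiffAt ℝ 1 f xbar) (hA : HasFDerivAt f A xbar)
    (hH : A.IsHurwitz) : IsAsymptoticallyStable f xbar := by
  obtain ⟨β, m, κ, hL⟩ := hH.exists_lyapunov
  obtain ⟨r, hr, hL⟩ := hL.exists_of_hasFDerivAt h0 hA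
  have hκ : 0 < κ := by linarith [hL.κ_pos]
  refine ⟨h0, ?_, fun ε hε => ?_, ?_⟩
  · obtain ⟨g, K, M, ρ, hρ, hK, hM, hg⟩ := exists_lipschitz_bounded_eqOn_ball hf
    have := FiniteDimensional.complete ℝ E
    have hLg := hL.mono (Metric.ball_subset_ball (min_le_left r ρ))
      (hg.mono (Metric.ball_subset_ball (min_le_right r ρ)))
    obtain ⟨δ, hδ, hstab⟩ := hLg.exists_dist_le (lt_min hr hρ) hρ
    refine ⟨δ, hδ, fun x₀ hx₀ => ?_⟩
    obtain ⟨x, hx0, hx⟩ := exists_isSolutionOn_Ici hK hM x₀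
    -- The solution of the cut-off system stays where the two vector fields agree.
    refine ⟨x, hx0, fun t ht => ?_⟩
    have hd := hstab t x (hx.mono Icc_subset_Ici_self) (by rwa [hx0]) t ⟨ht, le_rfl⟩
    have ht : 0 ≤ t := ht
    have : Real.exp (-(κ / 2 / 2) * t) ≤ 1 := Real.exp_le_one_iff.2 (by nlinarith)
    rw [← hg (Metric.mem_ball.2 (hd.trans_le (by nlinarith)))]
    exact hx t ht
  · obtain ⟨δ, hδ, hstab⟩ := hL.exists_dist_le hr hε
    refine ⟨δ, hδ, fun T x hx hx0 t ht => (hstab T x hx hx0 t ht).trans_le ?_⟩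
    have : Real.exp (-(κ / 2 / 2) * t) ≤ 1 := Real.exp_le_one_iff.2 (by nlinarith [ht.1])
    nlinarith
  · obtain ⟨δ, hδ, hstab⟩ := hL.exists_dist_le hr one_pos
    refine ⟨δ, hδ, fun x hx hx0 => ?_⟩
    rw [tendsto_iff_dist_tendsto_zero]
    have hexp : Filter.Tendsto (fun t : ℝ => 1 * Real.exp (-(κ / 2 / 2) * t)) Filter.atTop
        (𝓝 0) := by
      simp only [one_mul]
      exact Real.tendsto_exp_atBot.comp
        (Filter.tendsto_id.const_mul_atTop_of_neg (by linarith))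
    refine squeeze_zero' (Filter.Eventually.of_forall fun _ => dist_nonneg) ?_ hexp
    filter_upwards [Filter.eventually_ge_atTop 0] with t ht
    exact (hstab t x (hx.mono Icc_subset_Ici_self) hx0 t ⟨ht, le_rfl⟩).le

end IndirectMethod

/-! ### The derivative of the load currents -/

namespace ImG

theorem amplitude_pos {V : Fin 2 → ℝ} (hV : V ≠ 0) : 0 < amplitude V := by
  refine Real.sqrt_pos.2 ?_
  by_contra! h
  refine hV (funext fun i => ?_)
  have h0 : V 0 = 0 := by nlinarith [sq_nonneg (V 0), sq_nonneg (V 1)]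
  have h1 : V 1 = 0 := by nlinarith [sq_nonneg (V 0), sq_nonneg (V 1)]
  fin_cases i <;> simp [h0, h1]

theorem sq_amplitude (V : Fin 2 → ℝ) : amplitude V ^ 2 = V 0 ^ 2 + V 1 ^ 2 :=
  Real.sq_sqrt (by positivity)

theorem contDiffAt_amplitude {V : Fin 2 → ℝ} (hV : V ≠ 0) : ContDiffAt ℝ 1 amplitude V := by
  have h : V 0 ^ 2 + V 1 ^ 2 ≠ 0 := by
    rw [← sq_amplitude]; exact pow_ne_zero _ (amplitude_pos hV).ne'
  unfold amplitude
  exact ContDiffAt.sqrt (by fun_prop) h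

theorem hasDerivAt_amplitude_line {V : Fin 2 → ℝ} (hV : V ≠ 0) (w : Fin 2 → ℝ) :
    HasDerivAt (fun t : ℝ => amplitude (V + t • w)) ((V 0 * w 0 + V 1 * w 1) / amplitude V) 0 := by
  have h : V 0 ^ 2 + V 1 ^ 2 ≠ 0 := by
    rw [← sq_amplitude]; exact pow_ne_zero _ (amplitude_pos hV).ne'
  have h1 : ∀ i, HasDerivAt (fun t : ℝ => (V i + t * w i) ^ 2) (2 * V i * w i) 0 := fun i => by
    simpa using (((hasDerivAt_id (0 : ℝ)).mul_const (w i)).const_add (V i)).fun_pow 2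
  have h2 := ((h1 0).add (h1 1)).sqrt (by simpa using h)
  convert! h2 using 1
  · simp [amplitude]
    field_simp

/-- The dq current `g(|V|) V + h(|V|) J₂ V`. -/
noncomputable def polarCurrent (g h : ℝ → ℝ) (V : Fin 2 → ℝ) : Fin 2 → ℝ :=
  g (amplitude V) • V + h (amplitude V) • ![V 1, -V 0]

theorem contDiffAt_polarCurrent {g h : ℝ → ℝ} {V : Fin 2 → ℝ} (hV : V ≠ 0)
    (hg : ContDiffAt ℝ 1 g (amplitude V)) (hh : ContDiffAt ℝ 1 h (amplitude V)) :
    ContDiffAt ℝ 1 (polarCurrent g h) V := by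
  have hr := contDiffAt_amplitude hV
  refine ((hg.comp V hr).smul contDiffAt_id).add ((hh.comp V hr).smul ?_)
  refine contDiffAt_pi.2 fun i => ?_
  fin_cases i
  · exact contDiffAt_apply ℝ ℝ (1 : Fin 2) V
  · exact (contDiffAt_apply ℝ ℝ (0 : Fin 2) V).neg

/-- With the radial part `p / r` and the tangential part `q / r` of `w`, the quadratic form of the
derivative has the matrix `[[g + r g', r h' / 2], [r h' / 2, g]]`; the hypotheses are its trace and
determinant conditions for positive definiteness. -/
theorem polarCurrent_fderiv_pos {g h : ℝ → ℝ} {V : Fin 2 → ℝ} (hV : V ≠ 0) {g' h' : ℝ}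
    (hg : HasDerivAt g g' (amplitude V)) (hh : HasDerivAt h h' (amplitude V))
    (hd : DifferentiableAt ℝ (polarCurrent g h) V)
    (htr : 0 < 2 * g (amplitude V) + amplitude V * g')
    (hdet : (amplitude V * h') ^ 2 < 4 * g (amplitude V) * (g (amplitude V) + amplitude V * g'))
    {w : Fin 2 → ℝ} (hw : w ≠ 0) : 0 < w ⬝ᵥ fderiv ℝ (polarCurrent g h) V w := by
  set r := amplitude V with hr
  have hr0 : 0 < r := amplitude_pos hV
  have hr2 : r ^ 2 = V 0 ^ 2 + V 1 ^ 2 := sq_amplitude V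
  set r' := (V 0 * w 0 + V 1 * w 1) / r with hr'
  have hlin : HasDerivAt (fun t : ℝ => V + t • w) w 0 := by
    simpa using ((hasDerivAt_id (0 : ℝ)).smul_const w).const_add V
  have hF : HasDerivAt (fun t : ℝ => polarCurrent g h (V + t • w))
      (fderiv ℝ (polarCurrent g h) V w) 0 :=
    hd.hasFDerivAt.comp_hasDerivAt_of_eq (0 : ℝ) hlin (by simp)
  have ha := hasDerivAt_amplitude_line hV w
  have hg1 : HasDerivAt (fun t : ℝ => g (amplitude (V + t • w))) (g' * r') 0 :=
    HasDerivAt.comp_of_eq (0 : ℝ) hg ha (by simp [hr])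
  have hh1 : HasDerivAt (fun t : ℝ => h (amplitude (V + t • w))) (h' * r') 0 :=
    HasDerivAt.comp_of_eq (0 : ℝ) hh ha (by simp [hr])
  have hc := hasDerivAt_pi.1 hF
  have hl := hasDerivAt_pi.1 hlin
  have e0 : fderiv ℝ (polarCurrent g h) V w 0 =
      g' * r' * V 0 + g r * w 0 + (h' * r' * V 1 + h r * w 1) := by
    refine (hc 0).unique ?_
    convert! (hg1.fun_mul (hl 0)).fun_add (hh1.fun_mul (hl 1)) using 1
    simp [hr]
  have e1 : fderiv ℝ (polarCurrent g h) V w 1 =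
      g' * r' * V 1 + g r * w 1 - (h' * r' * V 0 + h r * w 0) := by
    refine (hc 1).unique ?_
    convert! (hg1.fun_mul (hl 1)).fun_sub (hh1.fun_mul (hl 0)) using 1
    · ext t
      simp [polarCurrent]
      ring
    · simp [hr]
  set p := V 0 * w 0 + V 1 * w 1 with hp
  set q := V 1 * w 0 - V 0 * w 1 with hq
  have hpq : p ^ 2 + q ^ 2 = r ^ 2 * (w 0 ^ 2 + w 1 ^ 2) := by rw [hr2]; ring
  have hpq0 : 0 < p ^ 2 + q ^ 2 := by
    rw [hpq, ← sq_amplitude]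
    have := amplitude_pos hw
    positivity
  have hgpos : 0 < g r := by
    -- The product `g (g + r g')` and the sum of the factors are positive, so both factors are.
    by_contra! hneg
    nlinarith [sq_nonneg (r * h')]
  have hr'' : r * r' = p := by rw [hr']; field_simp
  have hform : r ^ 2 * (w ⬝ᵥ fderiv ℝ (polarCurrent g h) V w) =
      (g r + r * g') * p ^ 2 + r * h' * (p * q) + g r * q ^ 2 := by
    rw [dotProduct, Fin.sum_univ_two, e0, e1]
    have : r ^ 2 * (w 0 * (g' * r' * V 0 + g r * w 0 + (h' * r' * V 1 + h r * w 1)) +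
        w 1 * (g' * r' * V 1 + g r * w 1 - (h' * r' * V 0 + h r * w 0))) =
        g r * (r ^ 2 * (w 0 ^ 2 + w 1 ^ 2)) + r * (r * r') * (g' * p + h' * q) := by
      rw [hp, hq]; ring
    rw [this, hr'', ← hpq]
    ring
  have h4 : 4 * g r * ((g r + r * g') * p ^ 2 + r * h' * (p * q) + g r * q ^ 2) =
      (2 * g r * q + r * h' * p) ^ 2 + (4 * g r * (g r + r * g') - (r * h') ^ 2) * p ^ 2 := by
    ring
  have hpos : 0 < (2 * g r * q + r * h' * p) ^ 2 +
      (4 * g r * (g r + r * g') - (r * h') ^ 2) * p ^ 2 := by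
    rcases eq_or_ne p 0 with h0 | h0
    · rw [h0] at hpq0 ⊢
      have : 0 < q ^ 2 := by simpa using hpq0
      have : 0 < (g r) ^ 2 * q ^ 2 := by positivity
      nlinarith
    · have : 0 < p ^ 2 := by positivity
      have := mul_pos (sub_pos.2 hdet) this
      positivity
  rw [← h4, ← hform] at hpos
  exact pos_of_mul_pos_right (pos_of_mul_pos_right hpos (by positivity)) (by positivity)

theorem Load.current_zip (p : ZIPParams) : (Load.zip p).current =
    polarCurrent (fun r => p.Pp / r ^ 2 + p.Ip / r + p.Yp)
      (fun r => p.Pq / r ^ 2 + p.Iq / r + p.Yq) := by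
  ext V i
  fin_cases i <;> simp [Load.current, polarCurrent] <;> ring

theorem Load.current_exponential (p : EXPParams) : (Load.exponential p).current =
    polarCurrent (fun r => p.P0 * r ^ (p.np - 2) / p.V0 ^ p.np)
      (fun r => p.Q0 * (r ^ (p.nq - 2) / p.V0 ^ p.nq)) := by
  ext V i
  fin_cases i <;> simp [Load.current, polarCurrent]
  ring

theorem hasDerivAt_zip_coefficient (P I Y : ℝ) {r : ℝ} (hr : r ≠ 0) :
    HasDerivAt (fun r => P / r ^ 2 + I / r + Y) (-2 * P / r ^ 3 - I / r ^ 2) r := by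
  have h1 := ((hasDerivAt_pow 2 r).fun_inv (pow_ne_zero 2 hr)).const_mul P
  have h2 := (hasDerivAt_inv hr).const_mul I
  convert! (h1.add h2).add_const Y using 1
  push_cast
  field_simp
  ring

theorem hasDerivAt_exponential_coefficient (n : ℝ) {r : ℝ} (hr : 0 < r) :
    HasDerivAt (fun r : ℝ => r ^ (n - 2)) ((n - 2) * r ^ n / r ^ 3) r := by
  convert! Real.hasDerivAt_rpow_const (x := r) (p := n - 2) (Or.inl hr.ne') using 1
  rw [show n - 2 - 1 = n - (3 : ℕ) by push_cast; ring, Real.rpow_sub_natCast hr.ne', mul_div_assoc]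

/-- The passivity condition makes the derivative of the load current positive definite. -/
theorem Load.contDiffAt_and_fderiv_pos (ℓ : Load) {V : Fin 2 → ℝ} (hV : V ≠ 0)
    (hℓ : ℓ.PassivityCondition (amplitude V)) :
    ContDiffAt ℝ 1 ℓ.current V ∧ ∀ w ≠ 0, 0 < w ⬝ᵥ fderiv ℝ ℓ.current V w := by
  have hr := amplitude_pos hV
  cases ℓ with
  | zip p =>
    obtain ⟨h1, h2⟩ := hℓ
    rw [Load.current_zip]
    have hC : ∀ P I Y : ℝ, ContDiffAt ℝ 1 (fun r => P / r ^ 2 + I / r + Y) (amplitude V) :=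
      fun P I Y => by
        have h2 : ContDiffAt ℝ 1 (fun r : ℝ => r ^ 2) (amplitude V) := contDiffAt_id.pow 2
        exact ((contDiffAt_const.div h2 (pow_ne_zero 2 hr.ne')).add
          (contDiffAt_const.div contDiffAt_id hr.ne')).add contDiffAt_const
    have hD := contDiffAt_polarCurrent hV (hC p.Pp p.Ip p.Yp) (hC p.Pq p.Iq p.Yq)
    refine ⟨hD, fun w hw => polarCurrent_fderiv_pos hV
      (hasDerivAt_zip_coefficient _ _ _ hr.ne') (hasDerivAt_zip_coefficient _ _ _ hr.ne')
      (hD.differentiableAt (by simp)) ?_ ?_ hw⟩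
    · generalize amplitude V = r at *
      have : 2 * (p.Pp / r ^ 2 + p.Ip / r + p.Yp) + r * (-2 * p.Pp / r ^ 3 - p.Ip / r ^ 2) =
        2 * (p.Yp + p.Ip / (2 * r)) := by field_simp; ring
      rw [this]; positivity
    · generalize amplitude V = r at *
      rw [← sub_pos] at h2 ⊢
      have : 4 * (p.Pp / r ^ 2 + p.Ip / r + p.Yp) * (p.Pp / r ^ 2 + p.Ip / r + p.Yp +
          r * (-2 * p.Pp / r ^ 3 - p.Ip / r ^ 2)) -
          (r * (-2 * p.Pq / r ^ 3 - p.Iq / r ^ 2)) ^ 2 =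
          4 / r ^ 4 * (p.Yp ^ 2 * r ^ 4 + p.Yp * p.Ip * r ^ 3 -
          (1 / 4 * p.Iq ^ 2 * r ^ 2 + (p.Ip * p.Pp + p.Iq * p.Pq) * r +
            (p.Pp ^ 2 + p.Pq ^ 2))) := by
        field_simp; ring
      rw [this]; positivity
  | exponential p =>
    obtain ⟨h1, h2⟩ := hℓ
    rw [Load.current_exponential]
    have hC : ∀ n : ℝ, ContDiffAt ℝ 1 (fun r : ℝ => r ^ (n - 2)) (amplitude V) := fun n =>
      contDiffAt_id.rpow_const_of_ne hr.ne'
    have hD := contDiffAt_polarCurrent hV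
      (g := fun r => p.P0 * r ^ (p.np - 2) / p.V0 ^ p.np)
      (h := fun r => p.Q0 * (r ^ (p.nq - 2) / p.V0 ^ p.nq))
      ((contDiffAt_const.mul (hC p.np)).div_const _)
      (contDiffAt_const.mul ((hC p.nq).div_const _))
    -- `n_p P₀ > 0` excludes `P₀ = 0`.
    have hP : 0 < p.P0 := by
      have := p.P0_nonneg
      rcases this.eq_or_lt with h | h
      · rw [← h] at h1; simp at h1
      · exact h
    have hV0 := p.V0_pos
    refine ⟨hD, fun w hw => polarCurrent_fderiv_pos hV
      (((hasDerivAt_exponential_coefficient p.np hr).const_mul p.P0).div_const _)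
      (((hasDerivAt_exponential_coefficient p.nq hr).div_const _).const_mul p.Q0)
      (hD.differentiableAt (by simp)) ?_ ?_ hw⟩
    · generalize amplitude V = r at *
      have hp : 0 < r ^ p.np := Real.rpow_pos_of_pos hr _
      have hv : 0 < p.V0 ^ p.np := Real.rpow_pos_of_pos hV0 _
      rw [Real.rpow_sub hr, Real.rpow_two]
      have : 2 * (p.P0 * (r ^ p.np / r ^ 2) / p.V0 ^ p.np) +
          r * (p.P0 * ((p.np - 2) * r ^ p.np / r ^ 3) / p.V0 ^ p.np) =
          p.np * p.P0 * (r ^ p.np / r ^ 2 / p.V0 ^ p.np) := by field_simp; ring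
      rw [this]; positivity
    · generalize amplitude V = r at *
      have hv : 0 < p.V0 ^ p.np := Real.rpow_pos_of_pos hV0 _
      have hv' : 0 < p.V0 ^ p.nq := Real.rpow_pos_of_pos hV0 _
      have hsq : ∀ n : ℝ, (r / p.V0) ^ (2 * n) = (r ^ n / p.V0 ^ n) ^ 2 := fun n => by
        rw [mul_comm, Real.rpow_mul (by positivity), Real.div_rpow hr.le hV0.le, Real.rpow_two]
      rw [hsq, hsq, ← sub_pos] at h2
      rw [Real.rpow_sub hr, Real.rpow_two, ← sub_pos]
      have : 4 * (p.P0 * (r ^ p.np / r ^ 2) / p.V0 ^ p.np) *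
          (p.P0 * (r ^ p.np / r ^ 2) / p.V0 ^ p.np +
            r * (p.P0 * ((p.np - 2) * r ^ p.np / r ^ 3) / p.V0 ^ p.np)) -
          (r * (p.Q0 * ((p.nq - 2) * r ^ p.nq / r ^ 3 / p.V0 ^ p.nq))) ^ 2 =
          1 / r ^ 4 * (4 * (p.np - 1) * p.P0 ^ 2 * (r ^ p.np / p.V0 ^ p.np) ^ 2 -
            (p.nq - 2) ^ 2 * p.Q0 ^ 2 * (r ^ p.nq / p.V0 ^ p.nq) ^ 2) := by field_simp; ring
      rw [this]; positivity

theorem contDiffAt_localCurrent {o : Option Load} {V : Fin 2 → ℝ} (hV : V ≠ 0)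
    (ho : ∀ ℓ ∈ o, ℓ.PassivityCondition (amplitude V)) : ContDiffAt ℝ 1 (localCurrent o) V := by
  cases o with
  | none => exact contDiffAt_const
  | some ℓ => exact (ℓ.contDiffAt_and_fderiv_pos hV (ho ℓ rfl)).1

theorem localCurrent_fderiv_nonneg {o : Option Load} {V : Fin 2 → ℝ} (hV : V ≠ 0)
    (ho : ∀ ℓ ∈ o, ℓ.PassivityCondition (amplitude V)) (w : Fin 2 → ℝ) :
    0 ≤ w ⬝ᵥ fderiv ℝ (localCurrent o) V w := by
  cases o with
  | none => simp [show localCurrent none = fun _ => 0 from rfl]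
  | some ℓ =>
    rcases eq_or_ne w 0 with rfl | hw
    · simp
    · exact ((ℓ.contDiffAt_and_fderiv_pos hV (ho ℓ rfl)).2 w hw).le

theorem localCurrent_fderiv_eq_zero {o : Option Load} {V : Fin 2 → ℝ} (hV : V ≠ 0)
    (ho : ∀ ℓ ∈ o, ℓ.PassivityCondition (amplitude V)) {w : Fin 2 → ℝ}
    (hw : w ⬝ᵥ fderiv ℝ (localCurrent o) V w = 0) :
    fderiv ℝ (localCurrent o) V w = 0 ∧ (o.isSome → w = 0) := by
  cases o with
  | none => simp [show localCurrent none = fun _ => 0 from rfl]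
  | some ℓ =>
    have : w = 0 := by
      by_contra hne
      exact ((ℓ.contDiffAt_and_fderiv_pos hV (ho ℓ rfl)).2 w hne).ne' hw
    simp [this]

end ImG

/-! ### Power balances of the subsystems -/

namespace ImG

namespace RLCFilter

variable (F : RLCFilter)

theorem output_apply (x : Fin 4 → ℝ) : F.output x = ![x 2 / F.Ct, x 3 / F.Ct] := by
  ext i
  fin_cases i <;>
    simp [output, K, Q, Matrix.mulVec, dotProduct, Fin.sum_univ_four, Matrix.diagonal_apply] <;>
    ring

theorem K_mulVec (d : Fin 2 → ℝ) : K *ᵥ d = ![0, 0, d 0, d 1] := by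
  ext i
  fin_cases i <;> simp [K, Matrix.mulVec, dotProduct, Fin.sum_univ_two]

theorem J_sub_R_mulVec (ω₀ : ℝ) (x : Fin 4 → ℝ) : (F.J ω₀ - F.R) *ᵥ (F.Q *ᵥ x) =
    ![ω₀ * x 1 - F.Rt * (x 0 / F.Lt) - x 2 / F.Ct, -(ω₀ * x 0) - F.Rt * (x 1 / F.Lt) - x 3 / F.Ct,
      x 0 / F.Lt + ω₀ * x 3, x 1 / F.Lt - ω₀ * x 2] := by
  have hL := F.Lt_pos.ne'
  have hC := F.Ct_pos.ne'
  ext i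
  fin_cases i <;>
    simp [J, R, Q, Matrix.mulVec, dotProduct, Fin.sum_univ_four, Matrix.diagonal_apply] <;>
    field_simp <;> ring

/-- The energy rate of the linear open-loop DGU is the supplied power minus the filter losses. -/
theorem power_balance (ω₀ : ℝ) (x : Fin 4 → ℝ) (d : Fin 2 → ℝ) :
    x ⬝ᵥ F.Q *ᵥ ((F.J ω₀ - F.R) *ᵥ (F.Q *ᵥ x) + K *ᵥ d) =
      F.output x ⬝ᵥ d - F.Rt * ((x 0 / F.Lt) ^ 2 + (x 1 / F.Lt) ^ 2) := by
  rw [J_sub_R_mulVec, K_mulVec, output_apply, Q]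
  simp [Matrix.mulVec_diagonal, dotProduct, Fin.sum_univ_four]
  have hL := F.Lt_pos.ne'
  have hC := F.Ct_pos.ne'
  field_simp
  ring

theorem Q_posSemidef : F.Q.PosSemidef := by
  refine Matrix.PosSemidef.diagonal fun i => ?_
  have hL := F.Lt_pos
  have hC := F.Ct_pos
  fin_cases i <;> simp [hL.le, hC.le]

end RLCFilter

theorem SatDGU.phs_sub (D : SatDGU) (ω₀ : ℝ) (x y : Fin 4 → ℝ) (d e : Fin 2 → ℝ) :
    D.phs ω₀ x d - D.phs ω₀ y e =
      (D.filter.J ω₀ - D.filter.R) *ᵥ (D.filter.Q *ᵥ (x - y)) + RLCFilter.K *ᵥ (d - e) := by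
  simp only [SatDGU.phs, RLCFilter.openLoop, Matrix.mulVec_sub]
  abel

theorem SatDGU.phs_eq_zero_unique (D : SatDGU) (ω₀ : ℝ) {x : Fin 4 → ℝ} {d e : Fin 2 → ℝ}
    (hd : D.phs ω₀ x d = 0) (he : D.phs ω₀ x e = 0) : d = e := by
  have h := D.phs_sub ω₀ x x d e
  rw [hd, he, sub_self, sub_self, Matrix.mulVec_zero, Matrix.mulVec_zero, zero_add,
    RLCFilter.K_mulVec] at h
  ext i
  fin_cases i
  · exact (sub_eq_zero.1 (congrFun h 2).symm : d 0 = e 0)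
  · exact (sub_eq_zero.1 (congrFun h 3).symm : d 1 = e 1)

/-- A saturated DGU is equilibrium-independent passive, with the shifted Hamiltonian as storage
function. -/
theorem SatDGU.isEIP (D : SatDGU) (ω₀ : ℝ) :
    IsEIP (D.phs ω₀) (fun x _ => D.filter.output x) (feasibleEquilibria (D.phs ω₀)) := by
  refine ⟨fun x ⟨d, hd⟩ => ⟨d, hd, fun e he => D.phs_eq_zero_unique ω₀ he hd⟩, ?_⟩
  let β : (Fin 4 → ℝ) →L[ℝ] (Fin 4 → ℝ) →L[ℝ] ℝ :=
    (Matrix.toLinearMap₂' ℝ D.filter.Q).toContinuousBilinearMap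
  have hβ : ∀ x y, β x y = x ⬝ᵥ D.filter.Q *ᵥ y := fun x y => by
    simp [β, Matrix.toLinearMap₂'_apply']
  have hsymm : ∀ x y, β x y = β y x := fun x y => by
    rw [hβ, hβ, RLCFilter.Q, dotProduct, dotProduct]
    exact Finset.sum_congr rfl fun i _ => by simp [Matrix.mulVec_diagonal]; ring
  have hpos : ∀ x, 0 ≤ β x x := fun x => by
    rw [hβ]; simpa using D.filter.Q_posSemidef.dotProduct_mulVec_nonneg x
  refine ⟨fun x xbar => 1 / 2 * β (x - xbar) (x - xbar), ?_, ?_, ?_⟩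
  · exact ContDiff.contDiffOn (by fun_prop)
  · intro x xbar _
    have := hpos (x - xbar)
    exact ⟨by positivity, by simp⟩
  · intro x xbar _ d dbar hbar
    have h1 : HasFDerivAt (fun y => y - xbar) (ContinuousLinearMap.id ℝ (Fin 4 → ℝ)) x :=
      (hasFDerivAt_id x).sub_const xbar
    have h2 := ((β.hasFDerivAt.comp x h1).clm_apply h1).const_mul (1 / 2)
    have h3 : fderiv ℝ (fun y => 1 / 2 * β (y - xbar) (y - xbar)) x (D.phs ω₀ x d) =
        β (x - xbar) (D.phs ω₀ x d) := by
      rw [HasFDerivAt.fderiv (by exact h2)]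
      have h4 := hsymm (D.phs ω₀ x d) (x - xbar)
      simp only [smul_apply, add_apply,
        ContinuousLinearMap.comp_apply, ContinuousLinearMap.flip_apply,
        ContinuousLinearMap.id_apply, Function.comp_apply, smul_eq_mul, h4]
      ring
    rw [h3, hβ, ← sub_zero (D.phs ω₀ x d), ← hbar, D.phs_sub, D.filter.power_balance]
    have hout : D.filter.output (x - xbar) = D.filter.output x - D.filter.output xbar := by
      simp [RLCFilter.output, Matrix.mulVec_sub]
    rw [hout, dotProduct_comm]
    have := D.filter.Rt_pos
    have : 0 ≤ D.filter.Rt *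
        (((x - xbar) 0 / D.filter.Lt) ^ 2 + ((x - xbar) 1 / D.filter.Lt) ^ 2) := by
      positivity
    linarith

namespace PHSDGU

variable (D : PHSDGU)

theorem K_mulVec (d : Fin 2 → ℝ) : K *ᵥ d = ![0, 0, d 0, d 1, 0, 0] := by
  ext i
  fin_cases i <;> simp [K, Matrix.mulVec, dotProduct, Fin.sum_univ_two]

theorem J_sub_R_mulVec (ω₀ : ℝ) (x : Fin 6 → ℝ) : (D.J ω₀ - D.R) *ᵥ (D.Q *ᵥ x) =
    ![D.α 0 * (x 0 / (D.filter.Lt * D.ν 0)) - D.ν 0 * (x 2 / D.filter.Ct),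
      D.α 1 * (x 1 / (D.filter.Lt * D.ν 1)) - D.ν 1 * (x 3 / D.filter.Ct),
      x 0 / D.filter.Lt + ω₀ * x 3 - x 4, x 1 / D.filter.Lt - ω₀ * x 2 - x 5,
      D.kI 0 * (x 2 / D.filter.Ct), D.kI 1 * (x 3 / D.filter.Ct)] := by
  have hL := D.filter.Lt_pos.ne'
  have hC := D.filter.Ct_pos.ne'
  have h0 := (D.ν_pos 0).ne'
  have h1 := (D.ν_pos 1).ne'
  have h2 := (D.kI_pos 0).ne'
  have h3 := (D.kI_pos 1).ne'
  ext i
  fin_cases i <;>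
    simp [J, R, Q, Matrix.mulVec, dotProduct, Fin.sum_univ_six, Matrix.diagonal_apply, h2, h3] <;>
    field_simp <;> ring

/-- The energy rate of the linear part of the closed loop is the supplied power minus the injected
damping. -/
theorem power_balance (ω₀ : ℝ) (x : Fin 6 → ℝ) (d : Fin 2 → ℝ) :
    x ⬝ᵥ D.Q *ᵥ ((D.J ω₀ - D.R) *ᵥ (D.Q *ᵥ x) + K *ᵥ d) =
      D.output x ⬝ᵥ d - (-D.α 0 * (x 0 / (D.filter.Lt * D.ν 0)) ^ 2 +
        -D.α 1 * (x 1 / (D.filter.Lt * D.ν 1)) ^ 2) := by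
  rw [J_sub_R_mulVec, K_mulVec, output, Q]
  simp [Matrix.mulVec_diagonal, dotProduct, Fin.sum_univ_six]
  have hL := D.filter.Lt_pos.ne'
  have hC := D.filter.Ct_pos.ne'
  have h0 := (D.ν_pos 0).ne'
  have h1 := (D.ν_pos 1).ne'
  have h2 := (D.kI_pos 0).ne'
  have h3 := (D.kI_pos 1).ne'
  field_simp
  ring

theorem Q_posSemidef : D.Q.PosSemidef := by
  refine Matrix.PosSemidef.diagonal fun i => ?_
  have hL := D.filter.Lt_pos
  have hC := D.filter.Ct_pos
  have h0 := D.ν_pos 0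
  have h1 := D.ν_pos 1
  have h2 := D.kI_pos 0
  have h3 := D.kI_pos 1
  fin_cases i <;> simp <;> positivity

end PHSDGU

namespace PIDGU

variable (D : PIDGU)

/-- The storage matrix `Ct⁻¹ blockdiag(1, P₂₂)` of a PI-controlled DGU, in the scale in which the
supply rate is the electrical power. -/
noncomputable def storage (P22 : Matrix (Fin 2 ⊕ Fin 2) (Fin 2 ⊕ Fin 2) ℝ) : Matrix PIIdx PIIdx ℝ :=
  (1 / D.filter.Ct) • Matrix.fromBlocks 1 0 0 P22

theorem storage_posSemidef {P22 : Matrix (Fin 2 ⊕ Fin 2) (Fin 2 ⊕ Fin 2) ℝ} (hP : P22.PosDef) :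
    (D.storage P22).PosSemidef := by
  have : (Matrix.fromBlocks (1 : Matrix (Fin 2) (Fin 2) ℝ) 0 0 P22).PosSemidef := by
    refine Matrix.PosSemidef.of_dotProduct_mulVec_nonneg ?_ fun x => ?_
    · rw [Matrix.isHermitian_fromBlocks_iff]
      exact ⟨Matrix.isHermitian_one, by simp, by simp, hP.1⟩
    · have h1 := hP.posSemidef.dotProduct_mulVec_nonneg (x ∘ Sum.inr)
      have h2 := dotProduct_self_star_nonneg (x ∘ Sum.inl)
      rw [Matrix.fromBlocks_mulVec]
      simp [dotProduct, Fintype.sum_sum_type] at h1 h2 ⊢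
      linarith
  exact this.smul (by have := D.filter.Ct_pos; positivity)

/-- The dissipation inequality for `F`, as passivity of the closed loop with respect to the
electrical power at the node. -/
theorem power_balance (ω₀ : ℝ) {P22 : Matrix (Fin 2 ⊕ Fin 2) (Fin 2 ⊕ Fin 2) ℝ} (hP : P22.PosDef)
    (hF : (-((D.F ω₀)ᵀ * Matrix.fromBlocks 1 0 0 P22
      + Matrix.fromBlocks 1 0 0 P22 * D.F ω₀)).PosSemidef) (x : PIIdx → ℝ) (d : Fin 2 → ℝ) :
    x ⬝ᵥ D.storage P22 *ᵥ (D.F ω₀ *ᵥ x + Sum.elim d 0) ≤ D.output x ⬝ᵥ d := by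
  have hC := D.filter.Ct_pos
  set B := Matrix.fromBlocks (1 : Matrix (Fin 2) (Fin 2) ℝ) 0 0 P22 with hB
  have hBt : Bᵀ = B := by
    have : P22ᵀ = P22 := by
      rw [← Matrix.conjTranspose_eq_transpose_of_trivial]; exact hP.1
    rw [hB, Matrix.fromBlocks_transpose, this]
    simp
  have h1 := hF.dotProduct_mulVec_nonneg x
  have h2 : x ⬝ᵥ ((D.F ω₀)ᵀ * B) *ᵥ x = x ⬝ᵥ B *ᵥ (D.F ω₀ *ᵥ x) := by
    rw [← Matrix.mulVec_mulVec, Matrix.dotProduct_mulVec, Matrix.vecMul_transpose, dotProduct_comm,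
      ← hBt, Matrix.mulVec_transpose, ← Matrix.dotProduct_mulVec, hBt]
  have h3 : x ⬝ᵥ B *ᵥ (D.F ω₀ *ᵥ x) ≤ 0 := by
    simp only [Matrix.neg_mulVec, Matrix.add_mulVec, dotProduct_neg, dotProduct_add, star_trivial,
      h2] at h1
    rw [← Matrix.mulVec_mulVec] at h1
    linarith
  have h4 : x ⬝ᵥ B *ᵥ Sum.elim d 0 = (x ∘ Sum.inl) ⬝ᵥ d := by
    rw [hB, Matrix.fromBlocks_mulVec]
    simp [dotProduct, Fintype.sum_sum_type]
  have h5 : D.output x ⬝ᵥ d = 1 / D.filter.Ct * ((x ∘ Sum.inl) ⬝ᵥ d) := by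
    simp [output, dotProduct, Fin.sum_univ_two]
    ring
  rw [storage, Matrix.smul_mulVec, dotProduct_smul, smul_eq_mul, h5, Matrix.mulVec_add,
    dotProduct_add, h4]
  gcongr
  linarith

end PIDGU

theorem LoadNode.power_balance (N : LoadNode) (ω₀ : ℝ) (x d : Fin 2 → ℝ) :
    x ⬝ᵥ ((1 / N.C) • (1 : Matrix (Fin 2) (Fin 2) ℝ)) *ᵥ
      (!![0, ω₀ * N.C; -(ω₀ * N.C), 0] *ᵥ N.output x + d) = N.output x ⬝ᵥ d := by
  have hC := N.C_pos.ne'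
  simp [LoadNode.output, dotProduct, Matrix.mulVec, Fin.sum_univ_two, Matrix.one_apply]
  field_simp
  ring

theorem Line.power_balance (ℓ : Line) (ω₀ : ℝ) (x Va Vb : Fin 2 → ℝ) :
    x ⬝ᵥ ((1 / ℓ.L) • (1 : Matrix (Fin 2) (Fin 2) ℝ)) *ᵥ ℓ.field ω₀ x Va Vb =
      ℓ.current x ⬝ᵥ Va - ℓ.current x ⬝ᵥ Vb - ℓ.R * (ℓ.current x ⬝ᵥ ℓ.current x) := by
  have hL := ℓ.L_pos.ne'
  simp [Line.field, Line.current, dotProduct, Matrix.mulVec, Fin.sum_univ_two, Matrix.one_apply]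
  field_simp
  ring

end ImG

/-! ### The linearization of the microgrid -/

namespace ImG

namespace Microgrid

variable {Ds Dh Dp L P : Type*} (mg : Microgrid Ds Dh Dp L P)

theorem voltage_add (x y : State Ds Dh Dp L P) (k : Node Ds Dh Dp L) :
    mg.voltage (x + y) k = mg.voltage x k + mg.voltage y k := by
  rcases k with i | i | i | i <;> ext a <;> fin_cases a <;>
    simp [voltage, RLCFilter.output_apply, PHSDGU.output, PIDGU.output, LoadNode.output] <;> ring

theorem voltage_smul (c : ℝ) (x : State Ds Dh Dp L P) (k : Node Ds Dh Dp L) :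
    mg.voltage (c • x) k = c • mg.voltage x k := by
  rcases k with i | i | i | i <;> ext a <;> fin_cases a <;>
    simp [voltage, RLCFilter.output_apply, PHSDGU.output, PIDGU.output, LoadNode.output] <;> ring

/-- The voltage of a node as a linear function of the state. -/
noncomputable def voltageₗ (k : Node Ds Dh Dp L) : State Ds Dh Dp L P →ₗ[ℝ] (Fin 2 → ℝ) where
  toFun x := mg.voltage x k
  map_add' x y := mg.voltage_add x y k
  map_smul' c x := mg.voltage_smul c x k

variable [Fintype P]

theorem nodeInput_add (x y : State Ds Dh Dp L P) (k : Node Ds Dh Dp L) :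
    mg.nodeInput (x + y) k = mg.nodeInput x k + mg.nodeInput y k := by
  simp only [nodeInput, Line.current, Prod.snd_add, Pi.add_apply, smul_add, Finset.sum_add_distrib]
  abel

theorem nodeInput_smul (c : ℝ) (x : State Ds Dh Dp L P) (k : Node Ds Dh Dp L) :
    mg.nodeInput (c • x) k = c • mg.nodeInput x k := by
  simp only [nodeInput, Line.current, Prod.smul_snd, Pi.smul_apply, smul_comm _ c,
    ← Finset.smul_sum, smul_add, smul_neg]

/-- The part of the vector field that is linear in the state `p.1` and in the load currents
`p.2`. -/
noncomputable def linearPart :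
    (State Ds Dh Dp L P × (Node Ds Dh Dp L → Fin 2 → ℝ)) →ₗ[ℝ] State Ds Dh Dp L P where
  toFun p :=
    (fun i => ((mg.sat i).filter.J mg.ω₀ - (mg.sat i).filter.R) *ᵥ ((mg.sat i).filter.Q *ᵥ p.1.1 i)
        + RLCFilter.K *ᵥ (mg.nodeInput p.1 (.inl i) - p.2 (.inl i)),
      fun i => ((mg.phs i).J mg.ω₀ - (mg.phs i).R) *ᵥ ((mg.phs i).Q *ᵥ p.1.2.1 i)
        + PHSDGU.K *ᵥ (mg.nodeInput p.1 (.inr (.inl i)) - p.2 (.inr (.inl i))),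
      fun i => (mg.pi i).F mg.ω₀ *ᵥ p.1.2.2.1 i
        + Sum.elim (mg.nodeInput p.1 (.inr (.inr (.inl i))) - p.2 (.inr (.inr (.inl i)))) 0,
      fun j => !![0, mg.ω₀ * (mg.loadNode j).C; -(mg.ω₀ * (mg.loadNode j).C), 0] *ᵥ
          (mg.loadNode j).output (p.1.2.2.2.1 j)
        + (mg.nodeInput p.1 (.inr (.inr (.inr j))) - p.2 (.inr (.inr (.inr j)))),
      fun l => (mg.line l).field mg.ω₀ (p.1.2.2.2.2 l)
        (mg.voltage p.1 (mg.src l)) (mg.voltage p.1 (mg.dst l)))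
  map_add' p q := by
    have hs : ∀ a b : Fin 2 → ℝ,
        (Sum.elim (a + b) 0 : PIIdx → ℝ) = Sum.elim a 0 + Sum.elim b 0 := by
      intro a b; ext (i | i) <;> simp
    have hsub : ∀ a b c d : Fin 2 → ℝ, a + b - (c + d) = (a - c) + (b - d) := fun _ _ _ _ => by abel
    refine Prod.ext ?_ (Prod.ext ?_ (Prod.ext ?_ (Prod.ext ?_ ?_))) <;> funext i <;>
      simp only [Prod.fst_add, Prod.snd_add, Pi.add_apply, nodeInput_add, voltage_add, hsub, hs,
        Matrix.mulVec_add, LoadNode.output, Line.field, Line.current, smul_add] <;> abel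
  map_smul' c p := by
    have hs : ∀ a : Fin 2 → ℝ, (Sum.elim (c • a) 0 : PIIdx → ℝ) = c • Sum.elim a 0 := by
      intro a; ext (i | i) <;> simp
    refine Prod.ext ?_ (Prod.ext ?_ (Prod.ext ?_ (Prod.ext ?_ ?_))) <;> funext i <;>
      simp only [Prod.smul_fst, Prod.smul_snd, Pi.smul_apply, nodeInput_smul, voltage_smul,
        ← smul_sub, hs, Matrix.mulVec_smul, LoadNode.output, Line.field, Line.current,
        smul_comm _ c, ← smul_add, RingHom.id_apply]

/-- The constant part of the vector field: the saturated inverter voltages and the references of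
the controllers. -/
noncomputable def constantPart : State Ds Dh Dp L P :=
  (fun i => RLCFilter.G *ᵥ (mg.sat i).input,
    fun i => -(((mg.phs i).J mg.ω₀ - (mg.phs i).R) *ᵥ ((mg.phs i).Q *ᵥ (mg.phs i).center)),
    fun i => Sum.elim 0 (Sum.elim 0 (mg.pi i).Vref), 0, 0)

theorem field_eq (x : State Ds Dh Dp L P) : mg.field x =
    mg.linearPart (x, fun k => localCurrent (mg.loadAt k) (mg.voltage x k)) + mg.constantPart := by
  refine Prod.ext ?_ (Prod.ext ?_ (Prod.ext ?_ (Prod.ext ?_ ?_))) <;> funext i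
  · simp [field, linearPart, constantPart, SatDGU.phs, RLCFilter.openLoop, loadAt]
    abel
  · simp [field, linearPart, constantPart, PHSDGU.closedLoop, loadAt, Matrix.mulVec_sub]
    abel
  · ext (a | a)
    · simp [field, linearPart, constantPart, PIDGU.closedLoop, loadAt]
    · simp [field, linearPart, constantPart, PIDGU.closedLoop, loadAt]
  · have h : ∀ a b c : Fin 2 → ℝ, a - b + c = a + (c - b) + 0 := fun _ _ _ => by abel
    exact h _ _ _
  · simp [field, linearPart, constantPart]

variable [Fintype Ds] [Fintype Dh] [Fintype Dp] [Fintype L]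

/-- The linearization of the vector field of the microgrid at `xbar`. -/
noncomputable def linearization (xbar : State Ds Dh Dp L P) :
    State Ds Dh Dp L P →L[ℝ] State Ds Dh Dp L P :=
  mg.linearPart.toContinuousLinearMap ∘L (ContinuousLinearMap.id ℝ _).prod
    (ContinuousLinearMap.pi fun k => fderiv ℝ (localCurrent (mg.loadAt k)) (mg.voltage xbar k) ∘L
      (mg.voltageₗ k).toContinuousLinearMap)

theorem linearization_apply (xbar z : State Ds Dh Dp L P) : mg.linearization xbar z =
    mg.linearPart (z, fun k =>
      fderiv ℝ (localCurrent (mg.loadAt k)) (mg.voltage xbar k) (mg.voltage z k)) := rfl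

theorem contDiffAt_field_and_hasFDerivAt {xbar : State Ds Dh Dp L P}
    (hV : ∀ k, mg.voltage xbar k ≠ 0)
    (hload : ∀ k, ∀ ℓ ∈ mg.loadAt k, ℓ.PassivityCondition (amplitude (mg.voltage xbar k))) :
    ContDiffAt ℝ 1 mg.field xbar ∧ HasFDerivAt mg.field (mg.linearization xbar) xbar := by
  have hfield : mg.field = fun x => mg.linearPart.toContinuousLinearMap
      (x, fun k => localCurrent (mg.loadAt k) ((mg.voltageₗ k).toContinuousLinearMap x)) +
        mg.constantPart := funext mg.field_eq
  have hc : ∀ k, ContDiffAt ℝ 1 (localCurrent (mg.loadAt k)) (mg.voltage xbar k) :=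
    fun k => contDiffAt_localCurrent (hV k) (hload k)
  rw [hfield]
  constructor
  · refine ContDiffAt.add ?_ contDiffAt_const
    refine mg.linearPart.toContinuousLinearMap.contDiff.contDiffAt.comp xbar ?_
    refine contDiffAt_id.prodMk (contDiffAt_pi.2 fun k => ?_)
    exact (hc k).comp xbar (mg.voltageₗ k).toContinuousLinearMap.contDiff.contDiffAt
  · refine HasFDerivAt.add_const _ ?_
    refine mg.linearPart.toContinuousLinearMap.hasFDerivAt.comp xbar ?_
    refine (hasFDerivAt_id xbar).prodMk (hasFDerivAt_pi.2 fun k => ?_)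
    exact ((hc k).differentiableAt (by simp)).hasFDerivAt.comp xbar
      (mg.voltageₗ k).toContinuousLinearMap.hasFDerivAt

/-- Tellegen's theorem: the power that the lines feed into the nodes is the power that the
nodes feed into the lines, with the opposite sign. -/
theorem sum_voltage_dotProduct_nodeInput (z : State Ds Dh Dp L P) :
    ∑ k, mg.voltage z k ⬝ᵥ mg.nodeInput z k =
      -∑ l, ((mg.line l).current (z.2.2.2.2 l) ⬝ᵥ mg.voltage z (mg.src l) -
        (mg.line l).current (z.2.2.2.2 l) ⬝ᵥ mg.voltage z (mg.dst l)) := by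
  classical
  have h : ∀ φ : P → Node Ds Dh Dp L, ∑ k, mg.voltage z k ⬝ᵥ
      ∑ l with φ l = k, (mg.line l).current (z.2.2.2.2 l) =
      ∑ l, (mg.line l).current (z.2.2.2.2 l) ⬝ᵥ mg.voltage z (φ l) := by
    intro φ
    simp only [dotProduct_sum, Finset.sum_filter]
    rw [Finset.sum_comm]
    refine Finset.sum_congr rfl fun l _ => ?_
    rw [Finset.sum_eq_single (φ l) (fun k _ hk => by rw [if_neg hk.symm, dotProduct_zero])
      (fun hk => absurd (Finset.mem_univ _) hk), if_pos rfl, dotProduct_comm]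
  simp only [nodeInput, dotProduct_add, dotProduct_neg, Finset.sum_add_distrib,
    Finset.sum_neg_distrib, Finset.sum_sub_distrib]
  have h1 := h mg.src
  have h2 := h mg.dst
  rw [neg_sub, sub_eq_neg_add]
  rw [← h1, ← h2]

end Microgrid

end ImG

/-! ### Dissipation and stability of the linearization -/

/-- If `(a • x - b • y, b • x + a • y)` is the image of `(x, y)` under an operator, then `x + i y`
is an eigenvector for `a + i b`; the mixed terms with the factor `b` cancel by symmetry of `M`. -/
theorem Matrix.PosSemidef.eigenpair_nonneg {n : Type*} [Fintype n] {M : Matrix n n ℝ}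
    (hM : M.PosSemidef) {a : ℝ} (ha : 0 ≤ a) (b : ℝ) (x y : n → ℝ) :
    0 ≤ x ⬝ᵥ M *ᵥ (a • x - b • y) + y ⬝ᵥ M *ᵥ (b • x + a • y) := by
  have hMt : Mᵀ = M := by
    rw [← Matrix.conjTranspose_eq_transpose_of_trivial]; exact hM.1
  have hsymm : x ⬝ᵥ M *ᵥ y = y ⬝ᵥ M *ᵥ x := by
    rw [dotProduct_comm, ← hMt, Matrix.mulVec_transpose, ← Matrix.dotProduct_mulVec, hMt]
  have hx := hM.dotProduct_mulVec_nonneg x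
  have hy := hM.dotProduct_mulVec_nonneg y
  simp only [star_trivial] at hx hy
  simp only [Matrix.mulVec_sub, Matrix.mulVec_add, Matrix.mulVec_smul, dotProduct_sub,
    dotProduct_add, dotProduct_smul, smul_eq_mul, hsymm]
  have := mul_nonneg ha (add_nonneg hx hy)
  linarith

namespace ImG

theorem PIDGU.eq_zero_of_eigenpair (D : PIDGU) {ω₀ : ℝ} (hD : D.Admissible ω₀) {a : ℝ} (ha : 0 ≤ a)
    (b : ℝ) {x y : PIIdx → ℝ} (hx : D.F ω₀ *ᵥ x = a • x - b • y)
    (hy : D.F ω₀ *ᵥ y = b • x + a • y) : x = 0 ∧ y = 0 := by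
  by_contra hne
  have := hD.1 ⟨a, b⟩ ((Matrix.mem_spectrum_map_ofReal_iff _ _).2 ⟨x, y, by tauto, hx, hy⟩)
  simp at this
  linarith

/-- A mode of the open-loop DGU without filter current has no voltage. Here `u` and `v` are the real
and imaginary parts of the mode, in either order. -/
theorem RLCFilter.eq_zero_of_current_eq_zero (F : RLCFilter) (ω₀ : ℝ) {u v : Fin 4 → ℝ} {s t : ℝ}
    (hu : u 0 = 0 ∧ u 1 = 0) (hv : v 0 = 0 ∧ v 1 = 0)
    (h : (F.J ω₀ - F.R) *ᵥ (F.Q *ᵥ u) = s • u + t • v) : u = 0 := by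
  rw [F.J_sub_R_mulVec] at h
  have hC := F.Ct_pos.ne'
  have h0 := congrFun h 0
  have h1 := congrFun h 1
  simp [hu, hv, hC] at h0 h1
  ext k
  fin_cases k <;> simp [hu, h0, h1]

/-- A mode of the closed loop that is not damped has no voltage. -/
theorem PHSDGU.voltage_eq_zero_of_damped_eq_zero (D : PHSDGU) (ω₀ : ℝ) {u v : Fin 6 → ℝ} {s t : ℝ}
    (hu : u 0 = 0 ∧ u 1 = 0) (hv : v 0 = 0 ∧ v 1 = 0)
    (h : (D.J ω₀ - D.R) *ᵥ (D.Q *ᵥ u) = s • u + t • v) : u 2 = 0 ∧ u 3 = 0 := by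
  rw [D.J_sub_R_mulVec] at h
  have hC := D.filter.Ct_pos.ne'
  have h0 := congrFun h 0
  have h1 := congrFun h 1
  simp [hu, hv, hC, (D.ν_pos _).ne'] at h0 h1
  exact ⟨h0, h1⟩

/-- A mode of the closed loop that is not damped and has no voltage has no integrator state. -/
theorem PHSDGU.eq_zero_of_damped_eq_zero (D : PHSDGU) (ω₀ : ℝ) {u v : Fin 6 → ℝ} {s t : ℝ}
    (hu : u 0 = 0 ∧ u 1 = 0) (hu' : u 2 = 0 ∧ u 3 = 0) (hv : v 2 = 0 ∧ v 3 = 0)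
    (h : (D.J ω₀ - D.R) *ᵥ (D.Q *ᵥ u) = s • u + t • v) : u = 0 := by
  rw [D.J_sub_R_mulVec] at h
  have h0 := congrFun h 2
  have h1 := congrFun h 3
  simp [hu, hu', hv] at h0 h1
  ext k
  fin_cases k <;> simp [hu, hu', h0, h1]

namespace Microgrid

variable {Ds Dh Dp L P : Type*} (mg : Microgrid Ds Dh Dp L P)

theorem sat_dissipation_nonneg (z : State Ds Dh Dp L P) (i : Ds) :
    0 ≤ (mg.sat i).filter.Rt *
      ((z.1 i 0 / (mg.sat i).filter.Lt) ^ 2 + (z.1 i 1 / (mg.sat i).filter.Lt) ^ 2) := by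
  have := (mg.sat i).filter.Rt_pos
  positivity

theorem phs_dissipation_nonneg (z : State Ds Dh Dp L P) (i : Dh) :
    0 ≤ -(mg.phs i).α 0 * (z.2.1 i 0 / ((mg.phs i).filter.Lt * (mg.phs i).ν 0)) ^ 2 +
      -(mg.phs i).α 1 * (z.2.1 i 1 / ((mg.phs i).filter.Lt * (mg.phs i).ν 1)) ^ 2 := by
  have h0 := neg_pos.2 ((mg.phs i).α_neg 0)
  have h1 := neg_pos.2 ((mg.phs i).α_neg 1)
  positivity

theorem line_dissipation_nonneg (z : State Ds Dh Dp L P) (l : P) :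
    0 ≤ (mg.line l).R *
      ((mg.line l).current (z.2.2.2.2 l) ⬝ᵥ (mg.line l).current (z.2.2.2.2 l)) :=
  mul_nonneg (mg.line l).R_pos.le (by
    simpa using dotProduct_self_star_nonneg ((mg.line l).current (z.2.2.2.2 l)))

variable [Fintype P]

theorem nodeInput_eq_zero {z : State Ds Dh Dp L P} (hz : z.2.2.2.2 = 0) (k : Node Ds Dh Dp L) :
    mg.nodeInput z k = 0 := by
  simp [nodeInput, Line.current, hz]

variable [Fintype Ds] [Fintype Dh] [Fintype Dp] [Fintype L]

/-- The polar form of twice the total energy stored in the microgrid, where `P22` holds the lower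
right blocks of the storage matrices of the PI-controlled DGUs. -/
noncomputable def storageForm (P22 : Dp → Matrix (Fin 2 ⊕ Fin 2) (Fin 2 ⊕ Fin 2) ℝ)
    (z w : State Ds Dh Dp L P) : ℝ :=
  ∑ i, z.1 i ⬝ᵥ (mg.sat i).filter.Q *ᵥ w.1 i + ∑ i, z.2.1 i ⬝ᵥ (mg.phs i).Q *ᵥ w.2.1 i +
    ∑ i, z.2.2.1 i ⬝ᵥ (mg.pi i).storage (P22 i) *ᵥ w.2.2.1 i +
    ∑ j, z.2.2.2.1 j ⬝ᵥ ((1 / (mg.loadNode j).C) • (1 : Matrix (Fin 2) (Fin 2) ℝ)) *ᵥ w.2.2.2.1 j +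
    ∑ l, z.2.2.2.2 l ⬝ᵥ ((1 / (mg.line l).L) • (1 : Matrix (Fin 2) (Fin 2) ℝ)) *ᵥ w.2.2.2.2 l

theorem storageForm_eigenpair_nonneg {P22 : Dp → Matrix (Fin 2 ⊕ Fin 2) (Fin 2 ⊕ Fin 2) ℝ}
    (hP : ∀ i, (P22 i).PosDef) {a : ℝ} (ha : 0 ≤ a) (b : ℝ) (x y : State Ds Dh Dp L P) :
    0 ≤ mg.storageForm P22 x (a • x - b • y) + mg.storageForm P22 y (b • x + a • y) := by
  have hone : ∀ c : ℝ, 0 < c → ((1 / c) • (1 : Matrix (Fin 2) (Fin 2) ℝ)).PosSemidef := fun c hc =>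
    Matrix.PosSemidef.one.smul (by positivity)
  have h1 := Finset.sum_nonneg fun i (_ : i ∈ Finset.univ) =>
    (mg.sat i).filter.Q_posSemidef.eigenpair_nonneg ha b (x.1 i) (y.1 i)
  have h2 := Finset.sum_nonneg fun i (_ : i ∈ Finset.univ) =>
    (mg.phs i).Q_posSemidef.eigenpair_nonneg ha b (x.2.1 i) (y.2.1 i)
  have h3 := Finset.sum_nonneg fun i (_ : i ∈ Finset.univ) =>
    ((mg.pi i).storage_posSemidef (hP i)).eigenpair_nonneg ha b (x.2.2.1 i) (y.2.2.1 i)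
  have h4 := Finset.sum_nonneg fun j (_ : j ∈ Finset.univ) =>
    (hone _ (mg.loadNode j).C_pos).eigenpair_nonneg ha b (x.2.2.2.1 j) (y.2.2.2.1 j)
  have h5 := Finset.sum_nonneg fun l (_ : l ∈ Finset.univ) =>
    (hone _ (mg.line l).L_pos).eigenpair_nonneg ha b (x.2.2.2.2 l) (y.2.2.2.2 l)
  rw [Finset.sum_add_distrib] at h1 h2 h3 h4 h5
  simp only [storageForm, Prod.fst_sub, Prod.snd_sub, Prod.fst_add, Prod.snd_add, Prod.smul_fst,
    Prod.smul_snd, Pi.sub_apply, Pi.add_apply, Pi.smul_apply]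
  linarith

/-- The power dissipated at the displacement `z` from the equilibrium `xbar`, to second order: in
the filters of the saturated DGUs, in the controllers with damping assignment, in the lines and in
the loads. -/
noncomputable def dissipation (xbar z : State Ds Dh Dp L P) : ℝ :=
  ∑ i, (mg.sat i).filter.Rt *
      ((z.1 i 0 / (mg.sat i).filter.Lt) ^ 2 + (z.1 i 1 / (mg.sat i).filter.Lt) ^ 2) +
    ∑ i, (-(mg.phs i).α 0 * (z.2.1 i 0 / ((mg.phs i).filter.Lt * (mg.phs i).ν 0)) ^ 2 +
      -(mg.phs i).α 1 * (z.2.1 i 1 / ((mg.phs i).filter.Lt * (mg.phs i).ν 1)) ^ 2) +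
    ∑ l, (mg.line l).R *
      ((mg.line l).current (z.2.2.2.2 l) ⬝ᵥ (mg.line l).current (z.2.2.2.2 l)) +
    ∑ k, mg.voltage z k ⬝ᵥ
      fderiv ℝ (localCurrent (mg.loadAt k)) (mg.voltage xbar k) (mg.voltage z k)

/-- The stored energy changes at most at minus the rate of dissipation: the power exchanged between
the nodes and the lines cancels. -/
theorem storageForm_linearization_le {P22 : Dp → Matrix (Fin 2 ⊕ Fin 2) (Fin 2 ⊕ Fin 2) ℝ}
    (hP : ∀ i, (P22 i).PosDef)
    (hF : ∀ i, (-(((mg.pi i).F mg.ω₀)ᵀ * Matrix.fromBlocks 1 0 0 (P22 i)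
      + Matrix.fromBlocks 1 0 0 (P22 i) * (mg.pi i).F mg.ω₀)).PosSemidef)
    (xbar z : State Ds Dh Dp L P) :
    mg.storageForm P22 z (mg.linearization xbar z) ≤ -mg.dissipation xbar z := by
  set d : Node Ds Dh Dp L → Fin 2 → ℝ := fun k => mg.nodeInput z k -
    fderiv ℝ (localCurrent (mg.loadAt k)) (mg.voltage xbar k) (mg.voltage z k) with hd
  have hsat := fun i => (mg.sat i).filter.power_balance mg.ω₀ (z.1 i) (d (.inl i))
  have hphs := fun i => (mg.phs i).power_balance mg.ω₀ (z.2.1 i) (d (.inr (.inl i)))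
  have hpi := Finset.sum_le_sum (s := Finset.univ) fun i _ =>
    (mg.pi i).power_balance mg.ω₀ (hP i) (hF i) (z.2.2.1 i) (d (.inr (.inr (.inl i))))
  have hld := fun j =>
    (mg.loadNode j).power_balance mg.ω₀ (z.2.2.2.1 j) (d (.inr (.inr (.inr j))))
  have hln := fun l => (mg.line l).power_balance mg.ω₀ (z.2.2.2.2 l)
    (mg.voltage z (mg.src l)) (mg.voltage z (mg.dst l))
  have hnode : ∑ k, mg.voltage z k ⬝ᵥ d k = ∑ k, mg.voltage z k ⬝ᵥ mg.nodeInput z k -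
      ∑ k, mg.voltage z k ⬝ᵥ
        fderiv ℝ (localCurrent (mg.loadAt k)) (mg.voltage xbar k) (mg.voltage z k) := by
    simp only [hd, dotProduct_sub, Finset.sum_sub_distrib]
  rw [mg.sum_voltage_dotProduct_nodeInput] at hnode
  simp only [Fintype.sum_sum_type (f := fun k => mg.voltage z k ⬝ᵥ d k),
    Fintype.sum_sum_type (f := fun k => mg.voltage z (Sum.inr k) ⬝ᵥ d (Sum.inr k)),
    Fintype.sum_sum_type (f := fun k => mg.voltage z (Sum.inr (Sum.inr k)) ⬝ᵥ
      d (Sum.inr (Sum.inr k)))] at hnode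
  have e1 := Finset.sum_congr (rfl : (Finset.univ : Finset Ds) = _) fun i _ => hsat i
  have e2 := Finset.sum_congr (rfl : (Finset.univ : Finset Dh) = _) fun i _ => hphs i
  have e4 := Finset.sum_congr (rfl : (Finset.univ : Finset L) = _) fun i _ => hld i
  have e5 := Finset.sum_congr (rfl : (Finset.univ : Finset P) = _) fun i _ => hln i
  rw [Finset.sum_sub_distrib] at e1 e2 e5
  have hexp : mg.storageForm P22 z (mg.linearization xbar z) = _ :=
    congrArg₂ (· + ·) (congrArg₂ (· + ·) (congrArg₂ (· + ·) (congrArg₂ (· + ·) e1 e2) rfl) e4) e5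
  rw [hexp]
  simp only [dissipation]
  refine le_trans (add_le_add_left (add_le_add_left (add_le_add_right hpi _) _) _) ?_
  simp only [voltage] at hnode ⊢
  linarith

section NullDissipation

variable {mg} {xbar : State Ds Dh Dp L P}

theorem dissipation_nonneg (hV : ∀ k, mg.voltage xbar k ≠ 0)
    (hload : ∀ k, ∀ ℓ ∈ mg.loadAt k, ℓ.PassivityCondition (amplitude (mg.voltage xbar k)))
    (z : State Ds Dh Dp L P) : 0 ≤ mg.dissipation xbar z :=
  add_nonneg (add_nonneg (add_nonneg
    (Finset.sum_nonneg fun i _ => mg.sat_dissipation_nonneg z i)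
    (Finset.sum_nonneg fun i _ => mg.phs_dissipation_nonneg z i))
    (Finset.sum_nonneg fun l _ => mg.line_dissipation_nonneg z l))
    (Finset.sum_nonneg fun k _ => localCurrent_fderiv_nonneg (hV k) (hload k) _)

/-- Without dissipation the filter currents of the saturated DGUs, the damped states of the DGUs
with port-Hamiltonian control, the voltages of the lone-standing load nodes, the line currents and
the displacements of all load currents vanish. -/
theorem components_eq_zero_of_dissipation_eq_zero (hV : ∀ k, mg.voltage xbar k ≠ 0)
    (hload : ∀ k, ∀ ℓ ∈ mg.loadAt k, ℓ.PassivityCondition (amplitude (mg.voltage xbar k)))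
    {z : State Ds Dh Dp L P} (hz : mg.dissipation xbar z = 0) :
    (∀ i, z.1 i 0 = 0 ∧ z.1 i 1 = 0) ∧ (∀ i, z.2.1 i 0 = 0 ∧ z.2.1 i 1 = 0) ∧
    z.2.2.2.1 = 0 ∧ z.2.2.2.2 = 0 ∧
    ∀ k, fderiv ℝ (localCurrent (mg.loadAt k)) (mg.voltage xbar k) (mg.voltage z k) = 0 := by
  have n1 := fun i (_ : i ∈ Finset.univ) => mg.sat_dissipation_nonneg z i
  have n2 := fun i (_ : i ∈ Finset.univ) => mg.phs_dissipation_nonneg z i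
  have n3 := fun i (_ : i ∈ Finset.univ) => mg.line_dissipation_nonneg z i
  have n4 := fun k (_ : k ∈ Finset.univ) =>
    localCurrent_fderiv_nonneg (hV k) (hload k) (mg.voltage z k)
  have s1 := Finset.sum_nonneg n1
  have s2 := Finset.sum_nonneg n2
  have s3 := Finset.sum_nonneg n3
  have s4 := Finset.sum_nonneg n4
  rw [dissipation] at hz
  have z1 := (Finset.sum_eq_zero_iff_of_nonneg n1).1 (by linarith)
  have z2 := (Finset.sum_eq_zero_iff_of_nonneg n2).1 (by linarith)
  have z3 := (Finset.sum_eq_zero_iff_of_nonneg n3).1 (by linarith)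
  have z4 := (Finset.sum_eq_zero_iff_of_nonneg n4).1 (by linarith)
  have hload0 := fun k => localCurrent_fderiv_eq_zero (hV k) (hload k) (z4 k (Finset.mem_univ k))
  refine ⟨fun i => ?_, fun i => ?_, ?_, ?_, fun k => (hload0 k).1⟩
  · have hL := (mg.sat i).filter.Lt_pos.ne'
    have h := (mul_eq_zero.1 (z1 i (Finset.mem_univ i))).resolve_left (mg.sat i).filter.Rt_pos.ne'
    rw [add_eq_zero_iff_of_nonneg (sq_nonneg _) (sq_nonneg _)] at h
    simpa [hL] using h
  · have hL := (mg.phs i).filter.Lt_pos.ne'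
    have h0 := neg_pos.2 ((mg.phs i).α_neg 0)
    have h1 := neg_pos.2 ((mg.phs i).α_neg 1)
    have h := z2 i (Finset.mem_univ i)
    rw [add_eq_zero_iff_of_nonneg (by positivity) (by positivity)] at h
    simpa [hL, ((mg.phs i).ν_pos _).ne', ((mg.phs i).α_neg _).ne] using h
  · funext j
    have h : mg.voltage z (.inr (.inr (.inr j))) = 0 := (hload0 _).2 rfl
    exact (smul_eq_zero.1 h).resolve_left (one_div_pos.2 (mg.loadNode j).C_pos).ne'
  · funext l
    have h := (mul_eq_zero.1 (z3 l (Finset.mem_univ l))).resolve_left (mg.line l).R_pos.ne'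
    rw [dotProduct_self_eq_zero] at h
    exact (smul_eq_zero.1 h).resolve_left (one_div_pos.2 (mg.line l).L_pos).ne'

end NullDissipation

theorem linearization_isHurwitz (hpi : ∀ i, (mg.pi i).Admissible mg.ω₀)
    {xbar : State Ds Dh Dp L P} (hV : ∀ k, mg.voltage xbar k ≠ 0)
    (hload : ∀ k, ∀ ℓ ∈ mg.loadAt k, ℓ.PassivityCondition (amplitude (mg.voltage xbar k))) :
    (mg.linearization xbar).IsHurwitz := by
  intro a b x y ha hx hy
  choose P22 hP hF using fun i => (hpi i).2
  have hdiss := mg.storageForm_eigenpair_nonneg hP ha b x y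
  rw [← hx, ← hy] at hdiss
  have hWx := mg.storageForm_linearization_le hP hF xbar x
  have hWy := mg.storageForm_linearization_le hP hF xbar y
  have hDx := dissipation_nonneg hV hload x
  have hDy := dissipation_nonneg hV hload y
  obtain ⟨xs, xh, xl, xp, xk⟩ :=
    components_eq_zero_of_dissipation_eq_zero hV hload (z := x) (by linarith)
  obtain ⟨ys, yh, yl, yp, yk⟩ :=
    components_eq_zero_of_dissipation_eq_zero hV hload (z := y) (by linarith)
  -- The currents of lines and loads vanish, so every node is disconnected from the others.
  rw [linearization_apply] at hx hy
  simp only [linearPart, LinearMap.coe_mk, AddHom.coe_mk, xk, yk, sub_zero,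
    mg.nodeInput_eq_zero xp, mg.nodeInput_eq_zero yp, Matrix.mulVec_zero, add_zero] at hx hy
  rw [sub_eq_add_neg, ← neg_smul] at hx
  rw [add_comm] at hy
  have hxs := fun i => congrFun (congrArg (fun w => w.1) hx) i
  have hys := fun i => congrFun (congrArg (fun w => w.1) hy) i
  have hxh := fun i => congrFun (congrArg (fun w => w.2.1) hx) i
  have hyh := fun i => congrFun (congrArg (fun w => w.2.1) hy) i
  have hxp := fun i => congrFun (congrArg (fun w => w.2.2.1) hx) i
  have hyp := fun i => congrFun (congrArg (fun w => w.2.2.1) hy) i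
  have x1 : x.1 = 0 := funext fun i =>
    (mg.sat i).filter.eq_zero_of_current_eq_zero mg.ω₀ (xs i) (ys i) (hxs i)
  have y1 : y.1 = 0 := funext fun i =>
    (mg.sat i).filter.eq_zero_of_current_eq_zero mg.ω₀ (ys i) (xs i) (hys i)
  have xv := fun i =>
    (mg.phs i).voltage_eq_zero_of_damped_eq_zero mg.ω₀ (xh i) (yh i) (hxh i)
  have yv := fun i =>
    (mg.phs i).voltage_eq_zero_of_damped_eq_zero mg.ω₀ (yh i) (xh i) (hyh i)
  have x2 : x.2.1 = 0 := funext fun i =>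
    (mg.phs i).eq_zero_of_damped_eq_zero mg.ω₀ (xh i) (xv i) (yv i) (hxh i)
  have y2 : y.2.1 = 0 := funext fun i =>
    (mg.phs i).eq_zero_of_damped_eq_zero mg.ω₀ (yh i) (yv i) (xv i) (hyh i)
  have h0 : (Sum.elim 0 0 : PIIdx → ℝ) = 0 := by ext (i | i) <;> rfl
  have h3 : ∀ i, x.2.2.1 i = 0 ∧ y.2.2.1 i = 0 := fun i => by
    refine (mg.pi i).eq_zero_of_eigenpair (hpi i) ha b ?_ ?_
    · simpa [h0, sub_eq_add_neg] using hxp i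
    · simpa [h0, add_comm] using hyp i
  exact ⟨Prod.ext x1 (Prod.ext x2 (Prod.ext (funext fun i => (h3 i).1) (Prod.ext xl xp))),
    Prod.ext y1 (Prod.ext y2 (Prod.ext (funext fun i => (h3 i).2) (Prod.ext yl yp)))⟩

end Microgrid

end ImG

theorem proposition4 {Ds Dh Dp L P : Type*}
    [Fintype Ds] [Fintype Dh] [Fintype Dp] [Fintype L] [Fintype P]
    (mg : ImG.Microgrid Ds Dh Dp L P)
    -- the gains of the unsaturated PI-controlled DGUs are admissible
    (hpi : ∀ i, (mg.pi i).Admissible mg.ω₀)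
    -- an equilibrium of the microgrid with saturated DGUs and nonzero node voltages
    (xbar : ImG.State Ds Dh Dp L P)
    (hxbar : mg.field xbar = 0)
    (hV : ∀ k, mg.voltage xbar k ≠ 0)
    -- at its voltage amplitudes the passivity conditions of all loads hold
    (hload : ∀ k, ∀ ℓ ∈ mg.loadAt k,
      ℓ.PassivityCondition (ImG.amplitude (mg.voltage xbar k))) :
    (∀ i, xbar.1 i ∈ ImG.feasibleEquilibria ((mg.sat i).phs mg.ω₀) ∧
      ImG.IsEIP ((mg.sat i).phs mg.ω₀) (fun x _ => (mg.sat i).filter.output x)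
        (ImG.feasibleEquilibria ((mg.sat i).phs mg.ω₀))) ∧
    ImG.IsAsymptoticallyStable mg.field xbar := by
  refine ⟨fun i => ⟨⟨_, congrFun (congrArg Prod.fst hxbar) i⟩, (mg.sat i).isEIP mg.ω₀⟩, ?_⟩
  obtain ⟨h1, h2⟩ := mg.contDiffAt_field_and_hasFDerivAt hV hload
  exact isAsymptoticallyStable_of_isHurwitz hxbar h1 h2 (mg.linearization_isHurwitz hpi hV hload)
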